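/- \textbf{Setting.} Let $d \ge 1$. Let $\varphi$ be a probability measure on $\mathbb{R}$, absolutely continuous with respect to the Lebesgue measure, such that for $u_1 \sim \varphi$ one has $\mathbb{E}u_1 = 0$, $\mathbb{E}u_1^2 = 1$, $\mathbb{E}u_1^3 = 0$ and $r_4 := \mathbb{E}u_1^4 < \infty$; let $u = (u_1,\dots,u_d)$ have i.i.d. coordinates of law $\varphi$. Let $\Lambda = \{\lambda = (m, C) : m \in \mathbb{R}^d,\ C \in \mathbb{R}^{d\times d} \text{ diagonal and positive definite}\}$, with $\|\lambda\|_2^2 = \|m\|_2^2 + \|C\|_{\mathrm F}^2$, let $\mathcal{T}_\lambda(u) = Cu + m$, and let $q_\lambda$ be the law of $\mathcal{T}_\lambda(u)$ (mean-field location-scale family). Let $\ell : \mathbb{R}^d \to \mathbb{R}$ be twice differentiable and $\mu$-strongly convex with $\mu > 0$, that is, $\langle \nabla \ell(z), z - z'\rangle \ge \ell(z) - \ell(z') + \frac{\mu}{2}\|z - z'\|_2^2$ for all $z, z'$. Suppose that for some matrix $H \in \mathbb{R}^{d \times d}$ and constants $\delta \ge 0$, $L$ one has $\|\nabla^2 \ell(z)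 - H\|_2 \le \delta$ for all $z \in \mathbb{R}^d$ and $\mu \le \sigma_{\min}(H) \le \sigma_{\max}(H) \le L$. Let $h : \Lambda \to \mathbb{R} \cup \{+\infty\}$ be convex, lower semicontinuous and not identically $+\infty$. Put $f(\lambda) = \mathbb{E}_{z \sim q_\lambda} \ell(z)$ and $F = f + h$ on $\Lambda$. For $\gamma > 0$ let $\mathrm{prox}_{\gamma h}(x) = \operatorname{argmin}_{\lambda \in \Lambda}\{h(\lambda) + \frac{1}{2\gamma}\|x - \lambda\|_2^2\}$. Stochastic proximal gradient descent (SPGD) with the reparametrization gradient, started at $\lambda_0 \in \Lambda$, is $$\lambda_{t+1} = \mathrm{prox}_{\gamma_t h}\big(\lambda_t - \gamma_t \widehat{\nabla f}(\lambda_t; u_t)\big), \qquad \widehat{\nabla f}(\lambda; u) = \nabla_\lambda\, \ell(\mathcal{T}_\lambda(u)),$$ with $u_0, u_1, \dots$ i.i.d. copies of $u$. The two-stage step size with parameters $t_* \in \mathbb{N}$ and $\gamma_0$ is $\gamma_t = \gamma_0$ for $t \le t_*$ and $\gamma_t = \frac{1}{\mu}\frac{2t+1}{(t+1)^2}$ for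 $t \ge t_* + 1$. Let $$g = 2(1 + r_4)\frac{\|H\|_2^2}{\mu^2} + 4\frac{\delta^2}{\mu^2}\Big(\frac12 + r_4 + \mathbb{E}\max_{j=1,\dots,d} u_j^2\Big).$$ \textbf{Theorem.} There is a universal constant $c > 0$ such that, in every setting as above, the following hold. (i) $\ell$ has a unique minimizer $\bar z$. If $h$, extended by $+\infty$ outside $\Lambda$, is lower semicontinuous on the whole space of pairs $(m, C)$ with $C$ diagonal, then $F$ has a unique minimizer over $\Lambda$, and $\mathrm{prox}_{\gamma h}(x)$ exists and is unique for all $\gamma > 0$ and all $x$. (ii) Let $\lambda_* = (m_*, C_*) \in \Lambda$ be a minimizer of $F$ over $\Lambda$, let $\sigma_* \ge 0$ be given by $\sigma_*^2 = \|m_* - \bar z\|_2^2 + \|C_*\|_{\mathrm F}^2$, let $\lambda_0 \in \Lambda$ and $\Delta = \|\lambda_0 - \lambda_*\|_2$. Then there are $t_* \in \mathbb{N}$, $0 < \gamma_0 \le \frac{\mu}{2\mathcal{L}^2}$ with $\mathcal{L}^2 = \mu^2 g$, and $\varepsilon_0 > 0$ such that all iterates $(\lambda_t)_{t \ge 0}$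 of SPGD started at $\lambda_0$ with the two-stage step size satisfy, for all $T \in \mathbb{N}$ (with $\log^+ x = \max(0, \log x)$ and $\log 0$ read as $0$): (a) for every $\varepsilon > 0$, $$T \ge c\, g\Big(\frac{\sigma_*^2}{\varepsilon} + \frac{\sigma_* \log^+(\Delta^2/\sigma_*^2)}{\sqrt{\varepsilon}} + \log^+\frac{\Delta^2}{\varepsilon} + 1\Big) \ \Longrightarrow\ \mathbb{E}\|\lambda_T - \lambda_*\|_2^2 \le \varepsilon;$$ (b) for every $0 < \varepsilon \le \varepsilon_0$, $$T \ge c\, g\Big(\frac{\sigma_*^2}{\varepsilon} + \frac{\sigma_* \log(\Delta^2)}{\sqrt{\varepsilon}}\Big) \ \Longrightarrow\ \mathbb{E}\|\lambda_T - \lambda_*\|_2^2 \le \varepsilon.$$ -/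

import Mathlib

open MeasureTheory ProbabilityTheory Filter Topology

noncomputable section

namespace BBVI

/-- The Euclidean space `ℝ^d`. -/
abbrev Vec (d : ℕ) : Type := EuclideanSpace ℝ (Fin d)

/-- Parameters `λ = (m, C)` with `m ∈ ℝ^d` and `C` a diagonal `d × d` matrix, stored through its
diagonal.  The norm is `‖λ‖² = ‖m‖² + ‖C‖_F²`. -/
abbrev Param (d : ℕ) : Type := WithLp 2 (Vec d × Vec d)

/-- The location `m` of `λ = (m, C)`. -/
def loc {d : ℕ} (lam : Param d) : Vec d := lam.fst

/-- The diagonal of the scale matrix `C` of `λ = (m, C)`. -/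
def scale {d : ℕ} (lam : Param d) : Vec d := lam.snd

/-- The linear parametrization: `Λ = {(m, C) : C` diagonal and positive definite`}`. -/
def paramSet (d : ℕ) : Set (Param d) := {lam | ∀ i, 0 < scale lam i}

/-- The reparametrization function `T_λ(u) = C u + m` with `C` diagonal. -/
def reparam {d : ℕ} (lam : Param d) (u : Fin d → ℝ) : Vec d :=
  WithLp.toLp 2 (fun i => scale lam i * u i + loc lam i)

/-- The law `φ^{⊗ d}` of `u = (u_1, …, u_d)` with i.i.d. coordinates of law `φ`. -/
def baseLaw (d : ℕ) (φ : Measure ℝ) : Measure (Fin d → ℝ) := Measure.pi (fun _ => φ)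

/-- The member `q_λ` of the mean-field location-scale family with base distribution `φ`. -/
def meanField {d : ℕ} (φ : Measure ℝ) (lam : Param d) : Measure (Vec d) :=
  (baseLaw d φ).map (reparam lam)

/-- The base distribution: a probability measure dominated by the Lebesgue measure, standardized,
with vanishing third moment and finite fourth moment. -/
structure IsBase (φ : Measure ℝ) : Prop where
  prob : IsProbabilityMeasure φ
  ac : φ ≪ volume
  finite_fourth : Integrable (fun x : ℝ => x ^ 4) φ
  mean : ∫ x, x ∂φ = 0
  second : ∫ x, x ^ 2 ∂φ = 1
  third : ∫ x, x ^ 3 ∂φ = 0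

/-- The kurtosis `r₄ = E u_i⁴`. -/
def kurt (φ : Measure ℝ) : ℝ := ∫ x, x ^ 4 ∂φ

/-- `E max_{j = 1, …, d} u_j²`. -/
def expMaxSq (d : ℕ) (φ : Measure ℝ) : ℝ := ∫ u, (⨆ j, u j ^ 2) ∂(baseLaw d φ)

/-- A differentiable function `ℓ` is `μ`-strongly convex. -/
def IsStronglyConvex {d : ℕ} (ell : Vec d → ℝ) (μ : ℝ) : Prop :=
  0 < μ ∧ Differentiable ℝ ell ∧
    ∀ z z' : Vec d,
      ell z - ell z' + μ / 2 * ‖z - z'‖ ^ 2 ≤ inner ℝ (gradient ell z) (z - z')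

/-- The `ℓ₂` operator attached to a matrix. -/
abbrev op {d : ℕ} (H : Matrix (Fin d) (Fin d) ℝ) : Vec d →L[ℝ] Vec d :=
  Matrix.toEuclideanCLM (n := Fin d) (𝕜 := ℝ) H

/-- The largest singular value. -/
def sigmaMax {d : ℕ} (H : Matrix (Fin d) (Fin d) ℝ) : ℝ :=
  (op H : Vec d →ₗ[ℝ] Vec d).singularValues 0

/-- The smallest singular value (singular values are listed in decreasing order from index `0`). -/
def sigmaMin {d : ℕ} (H : Matrix (Fin d) (Fin d) ℝ) : ℝ :=
  (op H : Vec d →ₗ[ℝ] Vec d).singularValues (d - 1)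

/-- `ℓ` is twice differentiable and `‖∇²ℓ(z) - H‖₂ ≤ δ` for all `z`. -/
def HasAlmostConstantHessian {d : ℕ} (ell : Vec d → ℝ) (H : Matrix (Fin d) (Fin d) ℝ)
    (δ : ℝ) : Prop :=
  0 ≤ δ ∧ Differentiable ℝ ell ∧ Differentiable ℝ (gradient ell) ∧
    ∀ z, ‖fderiv ℝ (gradient ell) z - op H‖ ≤ δ

/-- `h : Λ → ℝ ∪ {+∞}` is convex, lower semicontinuous and not identically `+∞`.
Only the values of `h` on `Λ` matter. -/
structure IsRegularizer {d : ℕ} (h : Param d → EReal) : Prop where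
  ne_bot : ∀ x ∈ paramSet d, h x ≠ ⊥
  proper : ∃ x ∈ paramSet d, h x ≠ ⊤
  convex : ∀ x ∈ paramSet d, ∀ y ∈ paramSet d, ∀ a b : ℝ, 0 < a → 0 < b → a + b = 1 →
    h (a • x + b • y) ≤ (a : EReal) * h x + (b : EReal) * h y
  lsc : LowerSemicontinuousOn h (paramSet d)

open Classical in
/-- `h`, set to `+∞` off `Λ`, is lower semicontinuous on the whole parameter space. -/
def IsClosedRegularizer {d : ℕ} (h : Param d → EReal) : Prop :=
  LowerSemicontinuous (fun x => if x ∈ paramSet d then h x else ⊤)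

/-- `f(λ) = E_{z ∼ q_λ} ℓ(z)`. -/
def energy {d : ℕ} (ell : Vec d → ℝ) (φ : Measure ℝ) (lam : Param d) : ℝ :=
  ∫ z, ell z ∂(meanField φ lam)

/-- `F = f + h`. -/
def objective {d : ℕ} (ell : Vec d → ℝ) (φ : Measure ℝ) (h : Param d → EReal)
    (lam : Param d) : EReal :=
  (energy ell φ lam : EReal) + h lam

/-- `λ ∈ argmin_{Λ} F`. -/
def IsOptimum {d : ℕ} (ell : Vec d → ℝ) (φ : Measure ℝ) (h : Param d → EReal)
    (lam : Param d) : Prop :=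
  lam ∈ paramSet d ∧ IsMinOn (objective ell φ h) (paramSet d) lam

/-- The reparametrization gradient `∇_λ ℓ(T_λ(u))`. -/
def reparamGrad {d : ℕ} (ell : Vec d → ℝ) (lam : Param d) (u : Fin d → ℝ) : Param d :=
  gradient (fun lam' : Param d => ell (reparam lam' u)) lam

/-- `y = prox_{γ h}(x)`, i.e. `y` minimizes `h(y) + ‖x - y‖² / (2 γ)` over `Λ`. -/
def IsProx {d : ℕ} (h : Param d → EReal) (γ : ℝ) (x y : Param d) : Prop :=
  y ∈ paramSet d ∧
    IsMinOn (fun y' => h y' + ((1 / (2 * γ) * ‖x - y'‖ ^ 2 : ℝ) : EReal)) (paramSet d) y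

/-- The two-stage step size schedule. -/
def stepSize (μ γ₀ : ℝ) (tstar t : ℕ) : ℝ :=
  if t ≤ tstar then γ₀ else 1 / μ * ((2 * t + 1) / ((t : ℝ) + 1) ^ 2)

/-- `u_0, u_1, …` are i.i.d. with law `φ^{⊗ d}`. -/
structure IsNoise {d : ℕ} {Ω : Type*} [MeasurableSpace Ω] (P : Measure Ω) (φ : Measure ℝ)
    (u : ℕ → Ω → (Fin d → ℝ)) : Prop where
  measurable : ∀ t, Measurable (u t)
  law : ∀ t, P.map (u t) = baseLaw d φ
  indep : iIndepFun u P

/-- `(λ_t)` are the iterates of stochastic proximal gradient descent with the reparametrization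
gradient, started at `λ₀`, with noise `(u_t)` and step sizes `(γ_t)`. -/
structure IsSPGD {d : ℕ} {Ω : Type*} (ell : Vec d → ℝ) (h : Param d → EReal) (γ : ℕ → ℝ)
    (lam₀ : Param d) (u : ℕ → Ω → (Fin d → ℝ)) (lam : ℕ → Ω → Param d) : Prop where
  init : ∀ ω, lam 0 ω = lam₀
  step : ∀ t ω,
    IsProx h (γ t) (lam t ω - γ t • reparamGrad ell (lam t ω) (u t ω)) (lam (t + 1) ω)

/-- `g(d, H, δ, μ, φ)`. -/
def gConst {d : ℕ} (H : Matrix (Fin d) (Fin d) ℝ) (δ μ : ℝ) (φ : Measure ℝ) : ℝ :=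
  2 * (1 + kurt φ) * (‖op H‖ ^ 2 / μ ^ 2)
    + 4 * (δ ^ 2 / μ ^ 2) * (1 / 2 + kurt φ + expMaxSq d φ)

/-- `σ_*` with `σ_*² = ‖m_* - z̄‖² + ‖C_*‖_F²`. -/
def sigmaStar {d : ℕ} (lamStar : Param d) (zbar : Vec d) : ℝ :=
  Real.sqrt (‖loc lamStar - zbar‖ ^ 2 + ‖scale lamStar‖ ^ 2)

/-- `E ‖X - λ_*‖² ≤ ε`, the expectation being finite. -/
def MeanSqErrorLE {d : ℕ} {Ω : Type*} [MeasurableSpace Ω] (P : Measure Ω) (X : Ω → Param d)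
    (lamStar : Param d) (ε : ℝ) : Prop :=
  Integrable (fun ω => ‖X ω - lamStar‖ ^ 2) P ∧ ∫ ω, ‖X ω - lamStar‖ ^ 2 ∂P ≤ ε

end BBVI

end

noncomputable section

namespace BBVI

/-! ### Strongly convex functions with almost constant Hessian -/

section StronglyConvex

variable {d : ℕ}

/-! Everything reduces to one estimate, `integral_norm_sq_reparamGrad_sub_le`: the reparametrization
gradient is Lipschitz in mean square, with squared constant `μ² g`. The estimator is the adjoint of
the linear map `λ ↦ T_λ(u)` applied to `∇ℓ(T_λ(u))`, so coordinate `i` carries the weight `1 +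
u_i²`. By the mean value inequality for `∇ℓ - H`, a difference of gradients is `H` times the
displacement plus an error of norm at most `δ` times the displacement. In the `H` part every mixed
moment contains a first or third moment and vanishes, which leaves `1 + r₄` and no dimension factor.
Of the error only the norm is controlled, so its weights are replaced by `1 + max_j u_j²`; hence `E
max_j u_j²` enters through `δ` alone.

At the collapsed parameter `(z̄, 0)` the estimator is identically zero. Comparing with it bounds the
second moment at `λ_*` by `μ² g σ_*²`. Strong convexity passes from `ℓ` to the mean gradient with
the same `μ`, because `E‖T_v(u)‖² = ‖v‖²`. The proximal map is nonexpansive and `λ_*` is a fixed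
point of the exact step, so `E‖λ_{t+1} - λ_*‖² ≤ (1 - 2γμ + 2γ²μ²g) E‖λ_t - λ_*‖² + 2γ²μ²g σ_*²`,
and for `γ ≤ μ / (2μ²g)` the factor is at most `1 - γμ`.

`two_stage_recursion` solves this scalar recursion: the constant step brings the error to `2σ_*²` in
about `g (1 + log⁺(Δ²/σ_*²))` steps, after which the decreasing step makes `t² r_t` grow at most
linearly. For small `ε` the term `σ_*²/ε` absorbs the lower-order terms (`exists_small_accuracy`),
since `σ_* > 0`. -/

lemma gradient_remainder_le {ell : Vec d → ℝ} {H : Matrix (Fin d) (Fin d) ℝ} {δ : ℝ}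
    (hH : HasAlmostConstantHessian ell H δ) (z z' : Vec d) :
    ‖gradient ell z - gradient ell z' - op H (z - z')‖ ≤ δ * ‖z - z'‖ := by
  obtain ⟨_, _, hd, hb⟩ := hH
  have key := Convex.norm_image_sub_le_of_norm_hasFDerivWithin_le (𝕜 := ℝ)
    (f := fun x => gradient ell x - op H x) (f' := fun x => fderiv ℝ (gradient ell) x - op H)
    (C := δ) (s := Set.univ) (x := z') (y := z)
    (fun x _ => ((hd x).hasFDerivAt.sub (op H).hasFDerivAt).hasFDerivWithinAt)
    (fun x _ => hb x) convex_univ trivial trivial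
  refine le_trans (le_of_eq ?_) key
  rw [map_sub]
  congr 1
  abel

/-- The Lipschitz constant of `∇ℓ`. -/
def smoothness (H : Matrix (Fin d) (Fin d) ℝ) (δ : ℝ) : ℝ := ‖op H‖ + δ

lemma gradient_lipschitz {ell : Vec d → ℝ} {H : Matrix (Fin d) (Fin d) ℝ} {δ : ℝ}
    (hH : HasAlmostConstantHessian ell H δ) (z z' : Vec d) :
    ‖gradient ell z - gradient ell z'‖ ≤ smoothness H δ * ‖z - z'‖ := by
  have h1 := gradient_remainder_le hH z z'
  have h2 := (op H).le_opNorm (z - z')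
  have h3 := norm_add_le (gradient ell z - gradient ell z' - op H (z - z')) (op H (z - z'))
  rw [sub_add_cancel] at h3
  unfold smoothness
  linarith

lemma smoothness_nonneg {ell : Vec d → ℝ} {H : Matrix (Fin d) (Fin d) ℝ} {δ : ℝ}
    (hH : HasAlmostConstantHessian ell H δ) : 0 ≤ smoothness H δ :=
  add_nonneg (norm_nonneg _) hH.1

lemma gradient_strongly_monotone {ell : Vec d → ℝ} {μ : ℝ} (hc : IsStronglyConvex ell μ)
    (z z' : Vec d) :
    μ * ‖z - z'‖ ^ 2 ≤ inner ℝ (gradient ell z - gradient ell z') (z - z') := by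
  have h1 := hc.2.2 z z'
  have h2 := hc.2.2 z' z
  rw [← neg_sub z z', inner_neg_right, norm_neg] at h2
  rw [inner_sub_left]
  linarith

lemma lower_bound {ell : Vec d → ℝ} {μ : ℝ} (hc : IsStronglyConvex ell μ) (z z' : Vec d) :
    ell z + inner ℝ (gradient ell z) (z' - z) + μ / 2 * ‖z' - z‖ ^ 2 ≤ ell z' := by
  have h1 := hc.2.2 z z'
  rw [← neg_sub z' z, inner_neg_right, norm_neg] at h1
  linarith

/-- Convexity at `z'` together with the Lipschitz bound on `∇ℓ(z') - ∇ℓ(z)` avoids integrating along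
the segment. The lost factor `1/2` is harmless: the bound serves only for integrability, continuity
and first-order conditions, and its constant never reaches the rate. -/
lemma upper_bound {ell : Vec d → ℝ} {μ : ℝ} {H : Matrix (Fin d) (Fin d) ℝ} {δ : ℝ}
    (hc : IsStronglyConvex ell μ) (hH : HasAlmostConstantHessian ell H δ) (z z' : Vec d) :
    ell z' ≤ ell z + inner ℝ (gradient ell z) (z' - z) + smoothness H δ * ‖z' - z‖ ^ 2 := by
  have h1 := hc.2.2 z' z
  have h2 := real_inner_le_norm (gradient ell z' - gradient ell z) (z' - z)
  have h3 := mul_le_mul_of_nonneg_right (gradient_lipschitz hH z' z) (norm_nonneg (z' - z))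
  have h4 : 0 ≤ μ / 2 * ‖z' - z‖ ^ 2 := by have := hc.1; positivity
  rw [inner_sub_left] at h2
  nlinarith

lemma le_smoothness {ell : Vec d → ℝ} {μ : ℝ} {H : Matrix (Fin d) (Fin d) ℝ} {δ : ℝ}
    (hd : 0 < d) (hc : IsStronglyConvex ell μ) (hH : HasAlmostConstantHessian ell H δ) :
    μ ≤ smoothness H δ := by
  have : Nonempty (Fin d) := ⟨⟨0, hd⟩⟩
  obtain ⟨z, hz⟩ := exists_ne (0 : Vec d)
  have h1 := gradient_strongly_monotone hc z 0
  have h2 := real_inner_le_norm (gradient ell z - gradient ell 0) (z - 0)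
  have h3 := mul_le_mul_of_nonneg_right (gradient_lipschitz hH z 0) (norm_nonneg (z - 0))
  rw [sub_zero] at *
  have hp : 0 < ‖z‖ ^ 2 := by positivity
  exact le_of_mul_le_mul_right (by nlinarith) hp

lemma gradient_eq_zero_of_isMinOn {ell : Vec d → ℝ} {z : Vec d}
    (hz : IsMinOn ell Set.univ z) : gradient ell z = 0 := by
  have : fderiv ℝ ell z = 0 := (hz.isLocalMin Filter.univ_mem).fderiv_eq_zero
  rw [gradient, this, map_zero]

lemma tendsto_quadratic_atTop {a b m : ℝ} (hm : 0 < m) :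
    Tendsto (fun r : ℝ => a - b * r + m * r ^ 2) atTop atTop := by
  have h1 : Tendsto (fun r : ℝ => r * (m * r - b)) atTop atTop :=
    tendsto_id.atTop_mul_atTop₀
      (tendsto_atTop_add_const_right _ (-b) (tendsto_id.const_mul_atTop hm))
  refine (tendsto_atTop_add_const_left _ a h1).congr fun r => ?_
  ring

/-- The quadratic lower bound at `0` makes `ℓ` coercive; the same bound at a minimizer, where the
gradient vanishes, forces uniqueness. -/
lemma existsUnique_minimizer {ell : Vec d → ℝ} {μ : ℝ} (hc : IsStronglyConvex ell μ) :
    ∃! z : Vec d, IsMinOn ell Set.univ z := by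
  have hcoer : Tendsto ell (cocompact (Vec d)) atTop := by
    refine tendsto_atTop_mono (fun z => ?_)
      ((tendsto_quadratic_atTop (a := ell 0) (b := ‖gradient ell 0‖)
        (half_pos hc.1)).comp (tendsto_norm_cocompact_atTop (E := Vec d)))
    have h1 := lower_bound hc 0 z
    have h2 := neg_le_of_abs_le (abs_real_inner_le_norm (gradient ell 0) (z - 0))
    simp only [sub_zero, Function.comp_apply] at *
    linarith
  obtain ⟨z, hz⟩ := hc.2.1.continuous.exists_forall_le hcoer
  refine ⟨z, fun x _ => hz x, fun y hy => ?_⟩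
  have h1 := lower_bound hc y z
  rw [gradient_eq_zero_of_isMinOn hy, inner_zero_left] at h1
  have h2 := hz y
  have h3 : ‖z - y‖ ^ 2 ≤ 0 := by have := hc.1; nlinarith
  have h4 : ‖z - y‖ = 0 := by nlinarith [norm_nonneg (z - y)]
  exact (sub_eq_zero.1 (norm_eq_zero.1 h4)).symm

end StronglyConvex

/-! ### Moments of the base law -/

section Moments

variable {d : ℕ} {φ : Measure ℝ}

lemma IsBase.integrable_pow (hφ : IsBase φ) {n : ℕ} (hn : n ≤ 4) :
    Integrable (fun x : ℝ => x ^ n) φ := by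
  have := hφ.prob
  refine ((integrable_const (1 : ℝ)).add hφ.finite_fourth).mono' (by fun_prop)
    (ae_of_all _ fun x => ?_)
  rw [norm_pow, Real.norm_eq_abs]
  have h4 : |x| ^ 4 = x ^ 4 := by rw [← abs_pow, abs_of_nonneg (by positivity)]
  simp only [Pi.add_apply, ← h4]
  rcases le_total |x| 1 with h | h
  · have := pow_le_one₀ (n := n) (abs_nonneg x) h
    have : 0 ≤ |x| ^ 4 := by positivity
    linarith
  · have := pow_le_pow_right₀ h hn
    linarith

lemma IsBase.isProbabilityMeasure_baseLaw (hφ : IsBase φ) :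
    IsProbabilityMeasure (baseLaw d φ) := by
  have := hφ.prob
  unfold baseLaw
  infer_instance

lemma IsBase.one_le_kurt (hφ : IsBase φ) : 1 ≤ kurt φ := by
  have := hφ.prob
  have h0 : 0 ≤ ∫ x, (x ^ 4 - 2 * x ^ 2 + 1) ∂φ := by
    refine integral_nonneg fun x => ?_
    have := sq_nonneg (x ^ 2 - 1)
    simp only [Pi.zero_apply]
    nlinarith
  have I2 : Integrable (fun x : ℝ => 2 * x ^ 2) φ :=
    (hφ.integrable_pow (by norm_num)).const_mul 2
  have I : Integrable (fun x : ℝ => x ^ 4 - 2 * x ^ 2) φ := hφ.finite_fourth.sub I2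
  rw [integral_add I (integrable_const _), integral_sub hφ.finite_fourth I2,
    integral_const_mul, hφ.second] at h0
  simp only [integral_const, probReal_univ, smul_eq_mul] at h0
  unfold kurt
  linarith

/-- The monomial with exponents `n`. -/
def monomial (n : Fin d → ℕ) (u : Fin d → ℝ) : ℝ := ∏ l, u l ^ n l

lemma monomial_add (n m : Fin d → ℕ) (u : Fin d → ℝ) :
    monomial (n + m) u = monomial n u * monomial m u := by
  simp [monomial, pow_add, Finset.prod_mul_distrib]

lemma monomial_single (i : Fin d) (a : ℕ) (u : Fin d → ℝ) :
    monomial (Pi.single i a) u = u i ^ a := by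
  unfold monomial
  rw [Finset.prod_eq_single i] <;> simp +contextual

lemma IsBase.integrable_monomial (hφ : IsBase φ) {n : Fin d → ℕ} (hn : ∀ l, n l ≤ 4) :
    Integrable (monomial n) (baseLaw d φ) := by
  have := hφ.prob
  exact Integrable.fintype_prod (f := fun l x => x ^ n l) fun l => hφ.integrable_pow (hn l)

lemma IsBase.integral_monomial (hφ : IsBase φ) (n : Fin d → ℕ) :
    ∫ u, monomial n u ∂(baseLaw d φ) = ∏ l, ∫ x, x ^ n l ∂φ := by
  have := hφ.prob
  exact integral_fintype_prod_eq_prod (fun l (x : ℝ) => x ^ n l)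

/-- Independence factors the integral, and one factor is a vanishing first or third moment. -/
lemma IsBase.integral_monomial_eq_zero (hφ : IsBase φ) {n : Fin d → ℕ} {l : Fin d}
    (hl : n l = 1 ∨ n l = 3) : ∫ u, monomial n u ∂(baseLaw d φ) = 0 := by
  rw [hφ.integral_monomial]
  refine Finset.prod_eq_zero (Finset.mem_univ l) ?_
  rcases hl with h | h
  · simpa [h] using hφ.mean
  · simpa [h] using hφ.third

lemma IsBase.integrable_weighted_one (hφ : IsBase φ) (i : Fin d) :
    Integrable (fun u => 1 + u i ^ 2) (baseLaw d φ) := by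
  have := hφ.isProbabilityMeasure_baseLaw (d := d)
  have h : Integrable (fun u : Fin d → ℝ => u i ^ 2) (baseLaw d φ) := by
    refine (hφ.integrable_monomial (n := Pi.single i 2) fun l => ?_).congr
      (ae_of_all _ fun u => monomial_single i 2 u)
    rw [Pi.single_apply]; split_ifs <;> norm_num
  exact (integrable_const _).add h

lemma IsBase.integrable_sq (hφ : IsBase φ) (i : Fin d) :
    Integrable (fun u => u i ^ 2) (baseLaw d φ) := by
  have := hφ.prob
  exact integrable_comp_eval (μ := fun _ : Fin d => φ) (i := i) (f := fun x : ℝ => x ^ 2)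
    (hφ.integrable_pow (by norm_num))

lemma IsBase.integral_sq (hφ : IsBase φ) (i : Fin d) :
    ∫ u, u i ^ 2 ∂(baseLaw d φ) = 1 := by
  have := hφ.prob
  rw [← hφ.second]
  exact integral_comp_eval (μ := fun _ : Fin d => φ) (i := i) (f := fun x : ℝ => x ^ 2)
    (by fun_prop)

lemma IsBase.integrable_coord (hφ : IsBase φ) (i : Fin d) :
    Integrable (fun u => u i) (baseLaw d φ) := by
  have := hφ.prob
  exact integrable_comp_eval (μ := fun _ : Fin d => φ) (i := i) (f := fun x : ℝ => x)
    (by simpa using hφ.integrable_pow (n := 1) (by norm_num))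

lemma IsBase.integral_coord (hφ : IsBase φ) (i : Fin d) :
    ∫ u, u i ∂(baseLaw d φ) = 0 := by
  have := hφ.prob
  rw [← hφ.mean]
  exact integral_comp_eval (μ := fun _ : Fin d => φ) (i := i) (f := fun x : ℝ => x)
    (by fun_prop)

lemma IsBase.integrable_fourth (hφ : IsBase φ) (i : Fin d) :
    Integrable (fun u => u i ^ 4) (baseLaw d φ) := by
  have := hφ.prob
  exact integrable_comp_eval (μ := fun _ : Fin d => φ) (i := i) (f := fun x : ℝ => x ^ 4)
    hφ.finite_fourth

lemma IsBase.integral_fourth (hφ : IsBase φ) (i : Fin d) :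
    ∫ u, u i ^ 4 ∂(baseLaw d φ) = kurt φ := by
  have := hφ.prob
  exact integral_comp_eval (μ := fun _ : Fin d => φ) (i := i) (f := fun x : ℝ => x ^ 4)
    (by fun_prop)

lemma exponent_le_four (i j k : Fin d) (l : Fin d) :
    (Pi.single i 2 + Pi.single j 1 + Pi.single k 1 : Fin d → ℕ) l ≤ 4 := by
  simp only [Pi.add_apply, Pi.single_apply]
  split_ifs <;> norm_num

lemma monomial_sq_mul_mul (i j k : Fin d) (u : Fin d → ℝ) :
    monomial (Pi.single i 2 + Pi.single j 1 + Pi.single k 1) u = u i ^ 2 * (u j * u k) := by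
  rw [monomial_add, monomial_add, monomial_single, monomial_single, monomial_single]
  ring

lemma monomial_mul (j k : Fin d) (u : Fin d → ℝ) :
    monomial (Pi.single j 1 + Pi.single k 1) u = u j * u k := by
  rw [monomial_add, monomial_single, monomial_single]
  ring

lemma monomial_sq_mul (i j : Fin d) (u : Fin d → ℝ) :
    monomial (Pi.single i 2 + Pi.single j 1) u = u i ^ 2 * u j := by
  rw [monomial_add, monomial_single, monomial_single]
  ring

lemma IsBase.integrable_sq_mul_mul (hφ : IsBase φ) (i j k : Fin d) :
    Integrable (fun u => u i ^ 2 * (u j * u k)) (baseLaw d φ) :=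
  (hφ.integrable_monomial (exponent_le_four i j k)).congr
    (ae_of_all _ fun u => monomial_sq_mul_mul i j k u)

lemma IsBase.integrable_mul (hφ : IsBase φ) (j k : Fin d) :
    Integrable (fun u => u j * u k) (baseLaw d φ) := by
  refine (hφ.integrable_monomial fun l => ?_).congr
    (ae_of_all _ fun u => monomial_mul j k u)
  simp only [Pi.add_apply, Pi.single_apply]
  split_ifs <;> norm_num

lemma IsBase.integrable_sq_mul (hφ : IsBase φ) (i j : Fin d) :
    Integrable (fun u => u i ^ 2 * u j) (baseLaw d φ) := by
  refine (hφ.integrable_monomial fun l => ?_).congr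
    (ae_of_all _ fun u => monomial_sq_mul i j u)
  simp only [Pi.add_apply, Pi.single_apply]
  split_ifs <;> norm_num

lemma IsBase.integral_sq_mul (hφ : IsBase φ) (i j : Fin d) :
    ∫ u, u i ^ 2 * u j ∂(baseLaw d φ) = 0 := by
  simp_rw [← monomial_sq_mul]
  refine hφ.integral_monomial_eq_zero (l := j) ?_
  simp only [Pi.add_apply, Pi.single_apply]
  split_ifs <;> simp

lemma IsBase.integral_mul_of_ne (hφ : IsBase φ) {j k : Fin d} (hjk : j ≠ k) :
    ∫ u, u j * u k ∂(baseLaw d φ) = 0 := by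
  simp_rw [← monomial_mul]
  refine hφ.integral_monomial_eq_zero (l := j) ?_
  simp [hjk]

lemma IsBase.integral_sq_mul_mul_of_ne (hφ : IsBase φ) (i : Fin d) {j k : Fin d} (hjk : j ≠ k) :
    ∫ u, u i ^ 2 * (u j * u k) ∂(baseLaw d φ) = 0 := by
  simp_rw [← monomial_sq_mul_mul]
  refine hφ.integral_monomial_eq_zero (l := j) ?_
  simp only [Pi.add_apply, Pi.single_apply, if_neg hjk]
  split_ifs <;> simp

lemma IsBase.integral_sq_mul_sq_le (hφ : IsBase φ) (i j : Fin d) :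
    ∫ u, u i ^ 2 * (u j * u j) ∂(baseLaw d φ) ≤ kurt φ := by
  have := hφ.prob
  rcases eq_or_ne i j with rfl | hij
  · refine le_of_eq ?_
    rw [← hφ.integral_fourth i]
    congr 1 with u
    ring
  · refine le_trans (le_of_eq ?_) hφ.one_le_kurt
    simp_rw [← monomial_sq_mul_mul]
    rw [hφ.integral_monomial]
    refine Finset.prod_eq_one fun l _ => ?_
    simp only [Pi.add_apply, Pi.single_apply]
    by_cases hi : l = i
    · subst hi
      simpa [hij] using hφ.second
    · by_cases hj : l = j
      · simpa [hi, hj, hij.symm] using hφ.second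
      · simp [hi, hj]

/-! ### Second moments of affine forms with weight `1 + u_i²` -/

lemma weighted_square_expand (i : Fin d) (b : ℝ) (w : Fin d → ℝ) (u : Fin d → ℝ) :
    (1 + u i ^ 2) * (b + ∑ j, w j * u j) ^ 2
      = b ^ 2 * (1 + u i ^ 2) + ∑ j, (2 * b * w j) * (u j + u i ^ 2 * u j)
        + ∑ j, ∑ k, (w j * w k) * (u j * u k + u i ^ 2 * (u j * u k)) := by
  have h1 : ∑ j, (2 * b * w j) * (u j + u i ^ 2 * u j)
      = 2 * b * (1 + u i ^ 2) * ∑ j, w j * u j := by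
    rw [Finset.mul_sum]; exact Finset.sum_congr rfl fun j _ => by ring
  have h2 : ∑ j, ∑ k, (w j * w k) * (u j * u k + u i ^ 2 * (u j * u k))
      = (1 + u i ^ 2) * ((∑ j, w j * u j) * ∑ j, w j * u j) := by
    rw [Finset.sum_mul_sum, Finset.mul_sum]
    refine Finset.sum_congr rfl fun j _ => ?_
    rw [Finset.mul_sum]
    exact Finset.sum_congr rfl fun k _ => by ring
  rw [h1, h2]
  ring

lemma IsBase.integrable_weighted_square (hφ : IsBase φ) (i : Fin d) (b : ℝ) (w : Fin d → ℝ) :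
    Integrable (fun u => (1 + u i ^ 2) * (b + ∑ j, w j * u j) ^ 2) (baseLaw d φ) := by
  simp_rw [weighted_square_expand]
  refine (((hφ.integrable_weighted_one i).const_mul _).add
    (integrable_finsetSum _ fun j _ => ?_)).add
    (integrable_finsetSum _ fun j _ => integrable_finsetSum _ fun k _ => ?_)
  · exact ((hφ.integrable_coord j).add (hφ.integrable_sq_mul i j)).const_mul _
  · exact ((hφ.integrable_mul j k).add (hφ.integrable_sq_mul_mul i j k)).const_mul _

/-- Only the constant and the diagonal terms `j = k` survive integration. The constant has
coefficient `2 ≤ 1 + r₄`, and each diagonal term contributes `1 + E u_i² u_j² ≤ 1 + r₄`, with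
equality when `i = j`. -/
lemma IsBase.integral_weighted_square_le (hφ : IsBase φ) (i : Fin d) (b : ℝ) (w : Fin d → ℝ) :
    ∫ u, (1 + u i ^ 2) * (b + ∑ j, w j * u j) ^ 2 ∂(baseLaw d φ)
      ≤ (1 + kurt φ) * (b ^ 2 + ∑ j, w j ^ 2) := by
  have := hφ.isProbabilityMeasure_baseLaw (d := d)
  simp_rw [weighted_square_expand]
  have I1 : ∀ j, Integrable (fun u : Fin d → ℝ => (2 * b * w j) * (u j + u i ^ 2 * u j))
      (baseLaw d φ) := fun j =>
    ((hφ.integrable_coord j).add (hφ.integrable_sq_mul i j)).const_mul _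
  have I2 : ∀ j k, Integrable
      (fun u : Fin d → ℝ => (w j * w k) * (u j * u k + u i ^ 2 * (u j * u k)))
      (baseLaw d φ) := fun j k =>
    ((hφ.integrable_mul j k).add (hφ.integrable_sq_mul_mul i j k)).const_mul _
  have I3 : ∀ j, Integrable
      (fun u : Fin d → ℝ => ∑ k, (w j * w k) * (u j * u k + u i ^ 2 * (u j * u k)))
      (baseLaw d φ) := fun j => integrable_finsetSum _ fun k _ => I2 j k
  have I0 : Integrable (fun u : Fin d → ℝ => b ^ 2 * (1 + u i ^ 2)) (baseLaw d φ) :=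
    (hφ.integrable_weighted_one i).const_mul _
  have I01 : Integrable (fun u : Fin d → ℝ => b ^ 2 * (1 + u i ^ 2)
      + ∑ j, (2 * b * w j) * (u j + u i ^ 2 * u j)) (baseLaw d φ) :=
    I0.add (integrable_finsetSum _ fun j _ => I1 j)
  rw [integral_add I01 (integrable_finsetSum _ fun j _ => I3 j),
    integral_add I0 (integrable_finsetSum _ fun j _ => I1 j),
    integral_finsetSum _ fun j _ => I1 j, integral_finsetSum _ fun j _ => I3 j]
  have e0 : ∫ u : Fin d → ℝ, b ^ 2 * (1 + u i ^ 2) ∂(baseLaw d φ) = b ^ 2 * 2 := by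
    rw [integral_const_mul, integral_add (integrable_const _) (hφ.integrable_sq i),
      hφ.integral_sq]
    simp only [integral_const, probReal_univ, smul_eq_mul]
    ring
  have e1 : ∀ j, ∫ u : Fin d → ℝ, (2 * b * w j) * (u j + u i ^ 2 * u j) ∂(baseLaw d φ) = 0 := by
    intro j
    rw [integral_const_mul, integral_add (hφ.integrable_coord j) (hφ.integrable_sq_mul i j),
      hφ.integral_coord, hφ.integral_sq_mul]
    ring
  have e2 : ∀ j, ∫ u : Fin d → ℝ, ∑ k, (w j * w k) * (u j * u k + u i ^ 2 * (u j * u k))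
      ∂(baseLaw d φ) ≤ (1 + kurt φ) * w j ^ 2 := by
    intro j
    rw [integral_finsetSum _ fun k _ => I2 j k, Finset.sum_eq_single j]
    · rw [integral_const_mul, integral_add (hφ.integrable_mul j j)
        (hφ.integrable_sq_mul_mul i j j)]
      have h1 : ∫ u : Fin d → ℝ, u j * u j ∂(baseLaw d φ) = 1 := by
        rw [← hφ.integral_sq j]; simp_rw [pow_two]
      have h2 := hφ.integral_sq_mul_sq_le i j
      rw [h1]
      nlinarith [mul_self_nonneg (w j)]
    · intro k _ hk
      rw [integral_const_mul, integral_add (hφ.integrable_mul j k)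
        (hφ.integrable_sq_mul_mul i j k), hφ.integral_mul_of_ne hk.symm,
        hφ.integral_sq_mul_mul_of_ne i hk.symm]
      ring
    · simp
  rw [e0, Finset.sum_eq_zero fun j _ => e1 j, mul_add, Finset.mul_sum]
  have h3 := Finset.sum_le_sum fun j (_ : j ∈ Finset.univ) => e2 j
  have h4 := mul_le_mul_of_nonneg_left hφ.one_le_kurt (sq_nonneg b)
  linarith

lemma IsBase.integrable_affine_sq (hφ : IsBase φ) (i : Fin d) (a c : ℝ) :
    Integrable (fun u => (c * u i + a) ^ 2) (baseLaw d φ) := by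
  have := hφ.isProbabilityMeasure_baseLaw (d := d)
  have h := (((hφ.integrable_sq i).const_mul (c ^ 2)).add
    ((hφ.integrable_coord i).const_mul (2 * a * c))).add (integrable_const (a ^ 2))
  refine h.congr (ae_of_all _ fun u => ?_)
  simp only [Pi.add_apply]
  ring

lemma IsBase.integral_affine_sq (hφ : IsBase φ) (i : Fin d) (a c : ℝ) :
    ∫ u, (c * u i + a) ^ 2 ∂(baseLaw d φ) = a ^ 2 + c ^ 2 := by
  have := hφ.isProbabilityMeasure_baseLaw (d := d)
  have e : ∀ u : Fin d → ℝ, (c * u i + a) ^ 2 = c ^ 2 * u i ^ 2 + 2 * a * c * u i + a ^ 2 :=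
    fun u => by ring
  simp_rw [e]
  have I : Integrable (fun u : Fin d → ℝ => c ^ 2 * u i ^ 2 + 2 * a * c * u i) (baseLaw d φ) :=
    ((hφ.integrable_sq i).const_mul (c ^ 2)).add ((hφ.integrable_coord i).const_mul (2 * a * c))
  rw [integral_add I (integrable_const _),
    integral_add ((hφ.integrable_sq i).const_mul (c ^ 2))
    ((hφ.integrable_coord i).const_mul (2 * a * c)), integral_const_mul, integral_const_mul,
    hφ.integral_sq, hφ.integral_coord]
  simp only [integral_const, probReal_univ, smul_eq_mul]
  ring

/-- `max_j u_j²`. -/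
def maxSq (u : Fin d → ℝ) : ℝ := ⨆ j, u j ^ 2

/-! ### Moments with weight `max_j u_j²` -/

lemma sq_le_maxSq (u : Fin d → ℝ) (j : Fin d) : u j ^ 2 ≤ maxSq u :=
  le_ciSup (f := fun j => u j ^ 2) (Finite.bddAbove_range _) j

lemma maxSq_nonneg (u : Fin d → ℝ) : 0 ≤ maxSq u := Real.iSup_nonneg fun _ => sq_nonneg _

lemma maxSq_le_sum (u : Fin d → ℝ) : maxSq u ≤ ∑ j, u j ^ 2 :=
  Real.iSup_le (fun j => Finset.single_le_sum (f := fun j => u j ^ 2)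
    (fun _ _ => sq_nonneg _) (Finset.mem_univ j)) (Finset.sum_nonneg fun _ _ => sq_nonneg _)

lemma measurable_maxSq : Measurable (maxSq (d := d)) :=
  Measurable.iSup fun j => by fun_prop

lemma IsBase.integrable_maxSq (hφ : IsBase φ) : Integrable (maxSq (d := d)) (baseLaw d φ) := by
  refine (integrable_finsetSum Finset.univ fun j _ => hφ.integrable_sq j).mono'
    measurable_maxSq.aestronglyMeasurable (ae_of_all _ fun u => ?_)
  rw [Real.norm_of_nonneg (maxSq_nonneg u)]
  exact maxSq_le_sum u

lemma expMaxSq_eq : expMaxSq d φ = ∫ u, maxSq u ∂(baseLaw d φ) := rfl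

lemma IsBase.one_le_expMaxSq (hφ : IsBase φ) (hd : 0 < d) : 1 ≤ expMaxSq d φ := by
  rw [← hφ.integral_sq (⟨0, hd⟩ : Fin d), expMaxSq_eq]
  exact integral_mono (hφ.integrable_sq _) hφ.integrable_maxSq fun u => sq_le_maxSq u _

lemma maxSq_update_le (u : Fin d → ℝ) (i : Fin d) : maxSq (Function.update u i 0) ≤ maxSq u := by
  refine Real.iSup_le (fun j => ?_) (maxSq_nonneg u)
  rcases eq_or_ne j i with rfl | h
  · simpa using maxSq_nonneg u
  · simpa [h] using sq_le_maxSq u j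

lemma maxSq_le_add (u : Fin d → ℝ) (i : Fin d) :
    maxSq u ≤ u i ^ 2 + maxSq (Function.update u i 0) := by
  have h0 := maxSq_nonneg (Function.update u i 0)
  refine Real.iSup_le (fun j => ?_) (by positivity)
  rcases eq_or_ne j i with rfl | h
  · linarith
  · have := sq_le_maxSq (Function.update u i 0) j
    rw [Function.update_of_ne h] at this
    nlinarith [sq_nonneg (u i)]

lemma IsBase.integrable_sq_mul_sq (hφ : IsBase φ) (i j : Fin d) :
    Integrable (fun u => u i ^ 2 * u j ^ 2) (baseLaw d φ) := by
  simpa only [pow_two (_ : ℝ)] using hφ.integrable_sq_mul_mul i j j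

lemma IsBase.integrable_sq_mul_maxSq (hφ : IsBase φ) (i : Fin d) :
    Integrable (fun u => u i ^ 2 * maxSq u) (baseLaw d φ) := by
  refine (integrable_finsetSum Finset.univ fun j _ => hφ.integrable_sq_mul_sq i j).mono'
    (Measurable.aestronglyMeasurable (by have := measurable_maxSq (d := d); fun_prop))
    (ae_of_all _ fun u => ?_)
  rw [Real.norm_of_nonneg (mul_nonneg (sq_nonneg _) (maxSq_nonneg u)), ← Finset.mul_sum]
  exact mul_le_mul_of_nonneg_left (maxSq_le_sum u) (sq_nonneg _)

lemma measurable_maxSq_update (i : Fin d) :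
    Measurable (fun u : Fin d → ℝ => maxSq (Function.update u i 0)) :=
  measurable_maxSq.comp (measurable_pi_lambda _ fun j => by
    rcases eq_or_ne j i with rfl | h
    · simp
    · simpa [Function.update_of_ne h] using measurable_pi_apply j)

/-- With coordinate `i` zeroed, the maximum depends only on the other coordinates. It is therefore
independent of `u_i`, and `E u_i² = 1` factors out. -/
lemma IsBase.integral_sq_mul_maxSq_update (hφ : IsBase φ) (i : Fin d) :
    ∫ u, u i ^ 2 * maxSq (Function.update u i 0) ∂(baseLaw d φ)
      = ∫ u, maxSq (Function.update u i 0) ∂(baseLaw d φ) := by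
  have := hφ.prob
  have hind : iIndepFun (fun (j : Fin d) (u : Fin d → ℝ) => u j) (baseLaw d φ) :=
    iIndepFun_pi (μ := fun _ : Fin d => φ) (X := fun _ x => x) fun _ => aemeasurable_id
  have h2 := hind.indepFun_finset {i} (Finset.univ.erase i) (by simp)
    (fun j => measurable_pi_apply j)
  let f : (↥({i} : Finset (Fin d)) → ℝ) → ℝ := fun x => x ⟨i, by simp⟩ ^ 2
  let g : (↥(Finset.univ.erase i) → ℝ) → ℝ := fun y =>
    maxSq fun j => if h : j ∈ Finset.univ.erase i then y ⟨j, h⟩ else 0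
  have hf : Measurable f := by fun_prop
  have hg : Measurable g := measurable_maxSq.comp (measurable_pi_lambda _ fun j => by
    by_cases h : j ∈ Finset.univ.erase i
    · simp only [h, dite_true]; fun_prop
    · simp only [h, dite_false]; fun_prop)
  have key := h2.integral_fun_comp_mul_comp (f := f) (g := g)
    (Measurable.aemeasurable (by fun_prop)) (Measurable.aemeasurable (by fun_prop))
    hf.aestronglyMeasurable hg.aestronglyMeasurable
  have eg : ∀ u : Fin d → ℝ, g (fun j => u j) = maxSq (Function.update u i 0) := by
    intro u
    refine congrArg maxSq (funext fun j => ?_)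
    rcases eq_or_ne j i with rfl | h
    · simp
    · simp [h]
  simp only [eg, f] at key
  rw [key, hφ.integral_sq, one_mul]

/-- The maximum is at most `u_i²` plus the maximum over the other coordinates. The first term gives
`r₄`, the second decouples from `u_i`; this is why the two constants add instead of multiplying. -/
lemma IsBase.integral_sq_mul_maxSq_le (hφ : IsBase φ) (i : Fin d) :
    ∫ u, u i ^ 2 * maxSq u ∂(baseLaw d φ) ≤ kurt φ + expMaxSq d φ := by
  have Iu : Integrable (fun u : Fin d → ℝ => u i ^ 2 * maxSq (Function.update u i 0))
      (baseLaw d φ) := by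
    refine (hφ.integrable_sq_mul_maxSq i).mono' (Measurable.aestronglyMeasurable
      (by have := measurable_maxSq_update i; fun_prop)) (ae_of_all _ fun u => ?_)
    rw [Real.norm_of_nonneg (mul_nonneg (sq_nonneg _) (maxSq_nonneg _))]
    exact mul_le_mul_of_nonneg_left (maxSq_update_le u i) (sq_nonneg _)
  have Iv : Integrable (fun u : Fin d → ℝ => maxSq (Function.update u i 0)) (baseLaw d φ) := by
    refine hφ.integrable_maxSq.mono' (measurable_maxSq_update i).aestronglyMeasurable
      (ae_of_all _ fun u => ?_)
    rw [Real.norm_of_nonneg (maxSq_nonneg _)]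
    exact maxSq_update_le u i
  calc ∫ u, u i ^ 2 * maxSq u ∂(baseLaw d φ)
      ≤ ∫ u, (u i ^ 4 + u i ^ 2 * maxSq (Function.update u i 0)) ∂(baseLaw d φ) := by
        refine integral_mono (hφ.integrable_sq_mul_maxSq i) ((hφ.integrable_fourth i).add Iu)
          fun u => ?_
        have := mul_le_mul_of_nonneg_left (maxSq_le_add u i) (sq_nonneg (u i))
        simp only
        nlinarith
    _ = kurt φ + ∫ u, maxSq (Function.update u i 0) ∂(baseLaw d φ) := by
        rw [integral_add (hφ.integrable_fourth i) Iu, hφ.integral_fourth,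
          hφ.integral_sq_mul_maxSq_update]
    _ ≤ kurt φ + expMaxSq d φ := by
        gcongr
        exact integral_mono Iv hφ.integrable_maxSq fun u => maxSq_update_le u i

lemma IsBase.integrable_maxSq_affine_sq (hφ : IsBase φ) (i : Fin d) (a c : ℝ) :
    Integrable (fun u => maxSq u * (c * u i + a) ^ 2) (baseLaw d φ) := by
  refine ((hφ.integrable_maxSq.const_mul (2 * a ^ 2)).add
    ((hφ.integrable_sq_mul_maxSq i).const_mul (2 * c ^ 2))).mono'
    (Measurable.aestronglyMeasurable (by have := measurable_maxSq (d := d); fun_prop))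
    (ae_of_all _ fun u => ?_)
  rw [Real.norm_of_nonneg (mul_nonneg (maxSq_nonneg u) (sq_nonneg _))]
  simp only [Pi.add_apply]
  nlinarith [mul_nonneg (maxSq_nonneg u) (sq_nonneg (c * u i - a))]

lemma IsBase.integral_maxSq_affine_sq_le (hφ : IsBase φ) (i : Fin d) (a c : ℝ) :
    ∫ u, maxSq u * (c * u i + a) ^ 2 ∂(baseLaw d φ)
      ≤ 2 * (kurt φ + expMaxSq d φ) * (a ^ 2 + c ^ 2) := by
  calc ∫ u, maxSq u * (c * u i + a) ^ 2 ∂(baseLaw d φ)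
      ≤ ∫ u, (2 * a ^ 2 * maxSq u + 2 * c ^ 2 * (u i ^ 2 * maxSq u)) ∂(baseLaw d φ) := by
        refine integral_mono (hφ.integrable_maxSq_affine_sq i a c)
          ((hφ.integrable_maxSq.const_mul (2 * a ^ 2)).add
          ((hφ.integrable_sq_mul_maxSq i).const_mul (2 * c ^ 2))) fun u => ?_
        simp only
        nlinarith [mul_nonneg (maxSq_nonneg u) (sq_nonneg (c * u i - a))]
    _ = 2 * a ^ 2 * expMaxSq d φ + 2 * c ^ 2 * ∫ u, u i ^ 2 * maxSq u ∂(baseLaw d φ) := by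
        rw [integral_add (hφ.integrable_maxSq.const_mul (2 * a ^ 2))
          ((hφ.integrable_sq_mul_maxSq i).const_mul (2 * c ^ 2)), integral_const_mul,
          integral_const_mul, expMaxSq_eq]
    _ ≤ _ := by
        have h1 := mul_le_mul_of_nonneg_left (hφ.integral_sq_mul_maxSq_le i)
          (show 0 ≤ 2 * c ^ 2 by positivity)
        have h2 : 0 ≤ 2 * a ^ 2 * kurt φ := by
          have := hφ.one_le_kurt; positivity
        linarith

end Moments

/-! ### The reparametrization gradient -/

section Reparam

variable {d : ℕ} {φ : Measure ℝ}

lemma reparam_apply (v : Param d) (u : Fin d → ℝ) (i : Fin d) :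
    reparam v u i = scale v i * u i + loc v i := rfl

lemma loc_add (v w : Param d) (i : Fin d) : loc (v + w) i = loc v i + loc w i := rfl

lemma scale_add (v w : Param d) (i : Fin d) : scale (v + w) i = scale v i + scale w i := rfl

lemma loc_smul (r : ℝ) (v : Param d) (i : Fin d) : loc (r • v) i = r * loc v i := rfl

lemma scale_smul (r : ℝ) (v : Param d) (i : Fin d) : scale (r • v) i = r * scale v i := rfl

lemma reparam_add (v w : Param d) (u : Fin d → ℝ) :
    reparam (v + w) u = reparam v u + reparam w u := by
  ext i
  rw [PiLp.add_apply, reparam_apply, reparam_apply, reparam_apply, loc_add, scale_add]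
  ring

lemma reparam_smul (r : ℝ) (v : Param d) (u : Fin d → ℝ) :
    reparam (r • v) u = r • reparam v u := by
  ext i
  rw [PiLp.smul_apply, reparam_apply, reparam_apply, loc_smul, scale_smul, smul_eq_mul]
  ring

lemma continuous_reparam : Continuous fun p : Param d × (Fin d → ℝ) => reparam p.1 p.2 := by
  unfold reparam loc scale
  fun_prop

/-- `λ ↦ T_λ(u)` as a linear map. -/
def reparamLinear (u : Fin d → ℝ) : Param d →ₗ[ℝ] Vec d where
  toFun v := reparam v u
  map_add' v w := reparam_add v w u
  map_smul' r v := reparam_smul r v u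

/-- `λ ↦ T_λ(u)` as a continuous linear map. -/
def reparamCLM (u : Fin d → ℝ) : Param d →L[ℝ] Vec d where
  toLinearMap := reparamLinear u
  cont := continuous_reparam.comp (Continuous.prodMk_left u)

lemma reparamCLM_apply (u : Fin d → ℝ) (v : Param d) : reparamCLM u v = reparam v u := rfl

lemma reparam_sub (v w : Param d) (u : Fin d → ℝ) :
    reparam (v - w) u = reparam v u - reparam w u := by
  simp only [← reparamCLM_apply, map_sub]

/-- The adjoint of `λ ↦ T_λ(u)`. -/
def reparamAdj (u : Fin d → ℝ) (w : Vec d) : Param d :=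
  WithLp.toLp 2 (w, WithLp.toLp 2 fun i => u i * w i)

lemma reparamAdj_sub (u : Fin d → ℝ) (w w' : Vec d) :
    reparamAdj u w - reparamAdj u w' = reparamAdj u (w - w') := by
  have h : (WithLp.toLp 2 fun i => u i * w i : Vec d) - WithLp.toLp 2 (fun i => u i * w' i)
      = WithLp.toLp 2 fun i => u i * (w - w') i := by
    ext i
    simp [mul_sub]
  rw [reparamAdj, reparamAdj, reparamAdj, ← h]
  rfl

lemma reparamAdj_zero (u : Fin d → ℝ) : reparamAdj u 0 = 0 := by
  have := reparamAdj_sub u 0 0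
  rwa [sub_self, sub_self, eq_comm] at this

lemma inner_reparamAdj (u : Fin d → ℝ) (w : Vec d) (v : Param d) :
    inner ℝ (reparamAdj u w) v = inner ℝ w (reparam v u) := by
  rw [WithLp.prod_inner_apply]
  rw [PiLp.inner_apply, PiLp.inner_apply, PiLp.inner_apply, ← Finset.sum_add_distrib]
  refine Finset.sum_congr rfl fun i _ => ?_
  simp only [RCLike.inner_apply, conj_trivial, reparam_apply]
  change loc v i * w i + scale v i * (u i * w i) = _
  ring

lemma norm_sq_eq_sum (w : Vec d) : ‖w‖ ^ 2 = ∑ i, w i ^ 2 := by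
  rw [EuclideanSpace.norm_sq_eq]
  simp

lemma norm_sq_param (v : Param d) : ‖v‖ ^ 2 = ‖loc v‖ ^ 2 + ‖scale v‖ ^ 2 :=
  WithLp.prod_norm_sq_eq_of_L2 v

lemma norm_sq_param_eq_sum (v : Param d) :
    ‖v‖ ^ 2 = ∑ i, (loc v i ^ 2 + scale v i ^ 2) := by
  rw [norm_sq_param, norm_sq_eq_sum, norm_sq_eq_sum, Finset.sum_add_distrib]

lemma norm_sq_reparamAdj (u : Fin d → ℝ) (w : Vec d) :
    ‖reparamAdj u w‖ ^ 2 = ∑ i, (1 + u i ^ 2) * w i ^ 2 := by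
  rw [norm_sq_param_eq_sum]
  refine Finset.sum_congr rfl fun i _ => ?_
  change w i ^ 2 + (u i * w i) ^ 2 = _
  ring

lemma reparamGrad_eq {ell : Vec d → ℝ} (hd : Differentiable ℝ ell) (lam : Param d)
    (u : Fin d → ℝ) :
    reparamGrad ell lam u = reparamAdj u (gradient ell (reparam lam u)) := by
  refine HasGradientAt.gradient ?_
  rw [hasGradientAt_iff_hasFDerivAt]
  have h1 : HasFDerivAt ell (fderiv ℝ ell (reparamCLM u lam)) (reparamCLM u lam) :=
    (hd _).hasFDerivAt
  refine (h1.comp lam (reparamCLM u).hasFDerivAt).congr_fderiv ?_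
  ext v
  rw [InnerProductSpace.toDual_apply_apply, inner_reparamAdj, inner_gradient_left]
  rfl

lemma continuous_reparamGrad {ell : Vec d → ℝ} (hd : Differentiable ℝ ell)
    (hg : Continuous (gradient ell)) :
    Continuous fun p : Param d × (Fin d → ℝ) => reparamGrad ell p.1 p.2 := by
  simp_rw [reparamGrad_eq hd]
  have h : Continuous fun p : Param d × (Fin d → ℝ) => gradient ell (reparam p.1 p.2) :=
    hg.comp continuous_reparam
  unfold reparamAdj
  fun_prop

lemma norm_sq_reparam (v : Param d) (u : Fin d → ℝ) :
    ‖reparam v u‖ ^ 2 = ∑ i, (scale v i * u i + loc v i) ^ 2 := norm_sq_eq_sum _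

lemma IsBase.integrable_norm_sq_reparam (hφ : IsBase φ) (v : Param d) :
    Integrable (fun u => ‖reparam v u‖ ^ 2) (baseLaw d φ) := by
  simp_rw [norm_sq_reparam]
  exact integrable_finsetSum _ fun i _ => hφ.integrable_affine_sq i _ _

/-- Standardization makes `λ ↦ T_λ(u)` an isometry into `L²`, so quadratic bounds on `ℓ` become
quadratic bounds on the energy with the same constants. -/
lemma IsBase.integral_norm_sq_reparam (hφ : IsBase φ) (v : Param d) :
    ∫ u, ‖reparam v u‖ ^ 2 ∂(baseLaw d φ) = ‖v‖ ^ 2 := by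
  simp_rw [norm_sq_reparam]
  rw [integral_finsetSum _ fun i _ => hφ.integrable_affine_sq i _ _, norm_sq_param_eq_sum]
  exact Finset.sum_congr rfl fun i _ => hφ.integral_affine_sq i _ _

lemma op_apply (H : Matrix (Fin d) (Fin d) ℝ) (x : Vec d) (i : Fin d) :
    op H x i = ∑ j, H i j * x j := by
  simp [op, Matrix.mulVec, dotProduct]

lemma op_reparam_apply (H : Matrix (Fin d) (Fin d) ℝ) (v : Param d) (u : Fin d → ℝ) (i : Fin d) :
    op H (reparam v u) i = op H (loc v) i + ∑ j, (H i j * scale v j) * u j := by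
  rw [op_apply, op_apply, ← Finset.sum_add_distrib]
  refine Finset.sum_congr rfl fun j _ => ?_
  rw [reparam_apply]
  ring

lemma sum_sq_op_le (H : Matrix (Fin d) (Fin d) ℝ) (x : Vec d) :
    ∑ i, op H x i ^ 2 ≤ ‖op H‖ ^ 2 * ‖x‖ ^ 2 := by
  rw [← norm_sq_eq_sum, ← mul_pow]
  exact pow_le_pow_left₀ (norm_nonneg _) ((op H).le_opNorm x) 2

lemma sum_sq_column_le (H : Matrix (Fin d) (Fin d) ℝ) (j : Fin d) :
    ∑ i, H i j ^ 2 ≤ ‖op H‖ ^ 2 := by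
  have h := sum_sq_op_le H (EuclideanSpace.single j 1)
  simpa [op_apply] using h

/-- This is `‖H C‖_F ≤ ‖H‖₂ ‖C‖_F` for diagonal `C`, proved column by column: column `j` of `H` is
the image of a unit vector. -/
lemma sum_sq_scaled_le (H : Matrix (Fin d) (Fin d) ℝ) (x : Vec d) :
    ∑ i, ∑ j, (H i j * x j) ^ 2 ≤ ‖op H‖ ^ 2 * ‖x‖ ^ 2 := by
  rw [Finset.sum_comm, norm_sq_eq_sum x, Finset.mul_sum]
  refine Finset.sum_le_sum fun j _ => ?_
  simp_rw [mul_pow]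
  rw [← Finset.sum_mul]
  exact mul_le_mul_of_nonneg_right (sum_sq_column_le H j) (sq_nonneg _)

/-- A pointwise bound for `‖∇̂f(λ; u) - ∇̂f(λ'; u)‖²` in terms of `v = λ - λ'`. -/
def gradBound (H : Matrix (Fin d) (Fin d) ℝ) (δ : ℝ) (v : Param d) (u : Fin d → ℝ) : ℝ :=
  2 * ∑ i, (1 + u i ^ 2) * (op H (loc v) i + ∑ j, (H i j * scale v j) * u j) ^ 2
    + 2 * δ ^ 2 * ∑ i, ((scale v i * u i + loc v i) ^ 2
        + maxSq u * (scale v i * u i + loc v i) ^ 2)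

lemma IsBase.integrable_gradBound (hφ : IsBase φ) (H : Matrix (Fin d) (Fin d) ℝ) (δ : ℝ)
    (v : Param d) : Integrable (gradBound H δ v) (baseLaw d φ) := by
  refine ((integrable_finsetSum _ fun i _ => ?_).const_mul _).add
    ((integrable_finsetSum _ fun i _ => ?_).const_mul _)
  · exact hφ.integrable_weighted_square i _ _
  · exact (hφ.integrable_affine_sq i _ _).add (hφ.integrable_maxSq_affine_sq i _ _)

/-- The constant `g` is read off here. The linear part yields `2(1 + r₄)(‖H m‖² + ‖H C‖_F²)`; the
remainder yields `2δ²(1 + 2(r₄ + E max u_j²))‖v‖²`, and pulling out `2` gives the `4δ²(1/2 + ⋯)` of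
the definition. -/
lemma IsBase.integral_gradBound_le (hφ : IsBase φ) (H : Matrix (Fin d) (Fin d) ℝ) {δ μ : ℝ}
    (hμ : 0 < μ) (v : Param d) :
    ∫ u, gradBound H δ v u ∂(baseLaw d φ) ≤ μ ^ 2 * gConst H δ μ φ * ‖v‖ ^ 2 := by
  have I1 : ∀ i, Integrable (fun u : Fin d → ℝ => (1 + u i ^ 2)
      * (op H (loc v) i + ∑ j, (H i j * scale v j) * u j) ^ 2) (baseLaw d φ) :=
    fun i => hφ.integrable_weighted_square i _ _
  have I2 : ∀ i, Integrable (fun u : Fin d → ℝ => (scale v i * u i + loc v i) ^ 2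
        + maxSq u * (scale v i * u i + loc v i) ^ 2) (baseLaw d φ) :=
    fun i => (hφ.integrable_affine_sq i _ _).add (hφ.integrable_maxSq_affine_sq i _ _)
  unfold gradBound
  rw [integral_add ((integrable_finsetSum _ fun i _ => I1 i).const_mul _)
    ((integrable_finsetSum _ fun i _ => I2 i).const_mul _), integral_const_mul,
    integral_const_mul, integral_finsetSum _ fun i _ => I1 i,
    integral_finsetSum _ fun i _ => I2 i]
  have h1 := Finset.sum_le_sum fun i (_ : i ∈ Finset.univ) =>
    hφ.integral_weighted_square_le i (op H (loc v) i) (fun j => H i j * scale v j)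
  have h2 : ∀ i ∈ Finset.univ, ∫ u, ((scale v i * u i + loc v i) ^ 2
        + maxSq u * (scale v i * u i + loc v i) ^ 2) ∂(baseLaw d φ)
      ≤ (1 + 2 * (kurt φ + expMaxSq d φ)) * (loc v i ^ 2 + scale v i ^ 2) := by
    intro i _
    rw [integral_add (hφ.integrable_affine_sq i _ _) (hφ.integrable_maxSq_affine_sq i _ _),
      hφ.integral_affine_sq]
    have := hφ.integral_maxSq_affine_sq_le i (loc v i) (scale v i)
    linarith
  have h3 := Finset.sum_le_sum h2
  rw [← Finset.mul_sum, ← norm_sq_param_eq_sum] at h3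
  rw [← Finset.mul_sum, Finset.sum_add_distrib] at h1
  have h4 := sum_sq_op_le H (loc v)
  have h5 := sum_sq_scaled_le H (scale v)
  have hk : 0 ≤ 1 + kurt φ := by have := hφ.one_le_kurt; linarith
  have h6 := mul_le_mul_of_nonneg_left (add_le_add h4 h5) hk
  rw [← mul_add, ← norm_sq_param] at h6
  have h7 := mul_le_mul_of_nonneg_left h3 (show 0 ≤ 2 * δ ^ 2 by positivity)
  have h8 : μ ^ 2 * gConst H δ μ φ
      = 2 * (1 + kurt φ) * ‖op H‖ ^ 2 + 4 * δ ^ 2 * (1 / 2 + kurt φ + expMaxSq d φ) := by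
    unfold gConst
    field_simp
  rw [h8]
  linarith [h1.trans h6]

lemma norm_sq_reparamGrad_sub_le {ell : Vec d → ℝ} {H : Matrix (Fin d) (Fin d) ℝ} {δ : ℝ}
    (hH : HasAlmostConstantHessian ell H δ) (lam lam' : Param d) (u : Fin d → ℝ) :
    ‖reparamGrad ell lam u - reparamGrad ell lam' u‖ ^ 2 ≤ gradBound H δ (lam - lam') u := by
  rw [reparamGrad_eq hH.2.1, reparamGrad_eq hH.2.1, reparamAdj_sub, norm_sq_reparamAdj]
  set w := gradient ell (reparam lam u) - gradient ell (reparam lam' u) with hw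
  set y := reparam (lam - lam') u with hy
  set e := w - op H y with he
  have hrem : ‖e‖ ≤ δ * ‖y‖ := by
    have := gradient_remainder_le hH (reparam lam u) (reparam lam' u)
    rwa [← reparam_sub] at this
  -- The exact weight `1 + u_i²` is kept on the linear part, where moments cancel, and coarsened
  -- only on the error `e`.
  have h1 : ∀ i ∈ Finset.univ, (1 + u i ^ 2) * w i ^ 2
      ≤ 2 * ((1 + u i ^ 2) * (op H y i) ^ 2) + 2 * ((1 + maxSq u) * e i ^ 2) := by
    intro i _
    have hwi : w i = op H y i + e i := by rw [he]; simp
    have h2 : (1 + u i ^ 2) * e i ^ 2 ≤ (1 + maxSq u) * e i ^ 2 := by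
      have := sq_le_maxSq u i
      gcongr
    have h3 : 0 ≤ (1 + u i ^ 2) * (op H y i - e i) ^ 2 := by positivity
    rw [hwi]
    linarith
  refine (Finset.sum_le_sum h1).trans ?_
  rw [Finset.sum_add_distrib, ← Finset.mul_sum, ← Finset.mul_sum, ← Finset.mul_sum,
    ← norm_sq_eq_sum e]
  have h4 : ‖e‖ ^ 2 ≤ δ ^ 2 * ‖y‖ ^ 2 := by
    rw [← mul_pow]; exact pow_le_pow_left₀ (norm_nonneg _) hrem 2
  have h5 := mul_le_mul_of_nonneg_left h4 (show 0 ≤ 1 + maxSq u by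
    have := maxSq_nonneg u; linarith)
  have h6 : ‖y‖ ^ 2 = ∑ i, (scale (lam - lam') i * u i + loc (lam - lam') i) ^ 2 :=
    norm_sq_reparam _ _
  unfold gradBound
  rw [Finset.sum_add_distrib, ← Finset.mul_sum, ← h6]
  simp_rw [hy, op_reparam_apply] at h5 ⊢
  linarith

end Reparam

/-! ### Second moments of the gradient estimator -/

section Estimator

variable {d : ℕ} {φ : Measure ℝ} {ell : Vec d → ℝ} {μ δ : ℝ} {H : Matrix (Fin d) (Fin d) ℝ}

lemma HasAlmostConstantHessian.continuous_reparamGrad (hH : HasAlmostConstantHessian ell H δ) :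
    Continuous fun p : Param d × (Fin d → ℝ) => reparamGrad ell p.1 p.2 :=
  BBVI.continuous_reparamGrad hH.2.1 hH.2.2.1.continuous

lemma HasAlmostConstantHessian.continuous_reparamGrad_right
    (hH : HasAlmostConstantHessian ell H δ) (lam : Param d) : Continuous (reparamGrad ell lam) :=
  hH.continuous_reparamGrad.comp (Continuous.prodMk_right lam)

lemma integrable_norm_sq_reparamGrad_sub (hφ : IsBase φ) (hH : HasAlmostConstantHessian ell H δ)
    (lam lam' : Param d) :
    Integrable (fun u => ‖reparamGrad ell lam u - reparamGrad ell lam' u‖ ^ 2)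
      (baseLaw d φ) := by
  have c1 := hH.continuous_reparamGrad_right lam
  have c2 := hH.continuous_reparamGrad_right lam'
  refine (hφ.integrable_gradBound H δ (lam - lam')).mono'
    (Continuous.aestronglyMeasurable (by fun_prop)) (ae_of_all _ fun u => ?_)
  rw [Real.norm_of_nonneg (sq_nonneg _)]
  exact norm_sq_reparamGrad_sub_le hH lam lam' u

lemma integral_norm_sq_reparamGrad_sub_le (hφ : IsBase φ) (hμ : 0 < μ)
    (hH : HasAlmostConstantHessian ell H δ) (lam lam' : Param d) :
    ∫ u, ‖reparamGrad ell lam u - reparamGrad ell lam' u‖ ^ 2 ∂(baseLaw d φ)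
      ≤ μ ^ 2 * gConst H δ μ φ * ‖lam - lam'‖ ^ 2 :=
  (integral_mono (integrable_norm_sq_reparamGrad_sub hφ hH lam lam')
    (hφ.integrable_gradBound H δ (lam - lam'))
    fun u => norm_sq_reparamGrad_sub_le hH lam lam' u).trans (hφ.integral_gradBound_le H hμ _)

/-- The point mass `(z, 0)` as a parameter. -/
def pointMass (z : Vec d) : Param d := WithLp.toLp 2 (z, 0)

lemma reparam_pointMass (z : Vec d) (u : Fin d → ℝ) : reparam (pointMass z) u = z := by
  ext i
  simp [reparam_apply, pointMass, scale, loc]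

/-- The anchor of the noise bound: here the estimator vanishes for every `u`, not merely on average.
This parameter has zero scale, so the bounds on the estimator are stated on the whole space and not
on `Λ`. -/
lemma reparamGrad_pointMass (hd : Differentiable ℝ ell) {z : Vec d}
    (hz : IsMinOn ell Set.univ z) (u : Fin d → ℝ) : reparamGrad ell (pointMass z) u = 0 := by
  rw [reparamGrad_eq hd, reparam_pointMass, gradient_eq_zero_of_isMinOn hz, reparamAdj_zero]

lemma norm_sq_sub_pointMass (lam : Param d) (z : Vec d) :
    ‖lam - pointMass z‖ ^ 2 = sigmaStar lam z ^ 2 := by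
  rw [sigmaStar, Real.sq_sqrt (by positivity), norm_sq_param]
  congr 2
  simp [scale, pointMass]

lemma integrable_norm_sq_reparamGrad (hφ : IsBase φ) (hc : IsStronglyConvex ell μ)
    (hH : HasAlmostConstantHessian ell H δ) (lam : Param d) :
    Integrable (fun u => ‖reparamGrad ell lam u‖ ^ 2) (baseLaw d φ) := by
  obtain ⟨z, hz, _⟩ := existsUnique_minimizer hc
  have := integrable_norm_sq_reparamGrad_sub hφ hH lam (pointMass z)
  simpa only [reparamGrad_pointMass hH.2.1 hz, sub_zero] using this

lemma integral_norm_sq_reparamGrad_le (hφ : IsBase φ) (hc : IsStronglyConvex ell μ)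
    (hH : HasAlmostConstantHessian ell H δ) {z : Vec d} (hz : IsMinOn ell Set.univ z)
    (lam : Param d) :
    ∫ u, ‖reparamGrad ell lam u‖ ^ 2 ∂(baseLaw d φ)
      ≤ μ ^ 2 * gConst H δ μ φ * sigmaStar lam z ^ 2 := by
  have := integral_norm_sq_reparamGrad_sub_le hφ hc.1 hH lam (pointMass z)
  simpa only [reparamGrad_pointMass hH.2.1 hz, sub_zero, norm_sq_sub_pointMass] using this

lemma integrable_reparamGrad (hφ : IsBase φ) (hc : IsStronglyConvex ell μ)
    (hH : HasAlmostConstantHessian ell H δ) (lam : Param d) :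
    Integrable (reparamGrad ell lam) (baseLaw d φ) := by
  have := hφ.isProbabilityMeasure_baseLaw (d := d)
  refine ((integrable_const (1 : ℝ)).add (integrable_norm_sq_reparamGrad hφ hc hH lam)).mono'
    (hH.continuous_reparamGrad_right lam).aestronglyMeasurable (ae_of_all _ fun u => ?_)
  simp only [Pi.add_apply]
  nlinarith [sq_nonneg (‖reparamGrad ell lam u‖ - 1)]

/-- The mean `E ∇̂f(λ; u)` of the gradient estimator. -/
def meanGrad (ell : Vec d → ℝ) (φ : Measure ℝ) (lam : Param d) : Param d :=
  ∫ u, reparamGrad ell lam u ∂(baseLaw d φ)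

lemma integral_inner_reparamGrad (hφ : IsBase φ) (hc : IsStronglyConvex ell μ)
    (hH : HasAlmostConstantHessian ell H δ) (lam v : Param d) :
    ∫ u, inner ℝ (reparamGrad ell lam u) v ∂(baseLaw d φ) = inner ℝ (meanGrad ell φ lam) v := by
  simp_rw [real_inner_comm v]
  exact integral_inner (integrable_reparamGrad hφ hc hH lam) v

lemma inner_reparamGrad (hd : Differentiable ℝ ell) (lam v : Param d) (u : Fin d → ℝ) :
    inner ℝ (reparamGrad ell lam u) v = inner ℝ (gradient ell (reparam lam u)) (reparam v u) := by
  rw [reparamGrad_eq hd, inner_reparamAdj]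

lemma integrable_inner_reparamGrad (hφ : IsBase φ) (hc : IsStronglyConvex ell μ)
    (hH : HasAlmostConstantHessian ell H δ) (lam v : Param d) :
    Integrable (fun u => inner ℝ (reparamGrad ell lam u) v) (baseLaw d φ) :=
  (integrable_reparamGrad hφ hc hH lam).inner_const v

lemma meanGrad_strongly_monotone (hφ : IsBase φ) (hc : IsStronglyConvex ell μ)
    (hH : HasAlmostConstantHessian ell H δ) (lam lam' : Param d) :
    μ * ‖lam - lam'‖ ^ 2
      ≤ inner ℝ (meanGrad ell φ lam - meanGrad ell φ lam') (lam - lam') := by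
  rw [inner_sub_left, ← integral_inner_reparamGrad hφ hc hH,
    ← integral_inner_reparamGrad hφ hc hH, ← hφ.integral_norm_sq_reparam (lam - lam'),
    ← integral_const_mul, ← integral_sub (integrable_inner_reparamGrad hφ hc hH _ _)
      (integrable_inner_reparamGrad hφ hc hH _ _)]
  refine integral_mono ((hφ.integrable_norm_sq_reparam _).const_mul _)
    ((integrable_inner_reparamGrad hφ hc hH _ _).sub
      (integrable_inner_reparamGrad hφ hc hH _ _)) fun u => ?_
  simp only
  rw [inner_reparamGrad hc.2.1, inner_reparamGrad hc.2.1, ← inner_sub_left, reparam_sub]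
  exact gradient_strongly_monotone hc _ _

/-- Meant for `a`, `b` the estimators at the iterate and at the optimum, with `G = E b`. The term
`‖b - G‖²` is left expanded so that it integrates to `E‖b‖² - ‖G‖²`. -/
lemma sq_norm_sub_smul_le {E : Type*} [NormedAddCommGroup E] [InnerProductSpace ℝ E]
    (V a b G : E) (γ : ℝ) :
    ‖V - γ • (a - G)‖ ^ 2 ≤ ‖V‖ ^ 2 - 2 * γ * inner ℝ a V + 2 * γ * inner ℝ G V
      + 2 * γ ^ 2 * ‖a - b‖ ^ 2
      + 2 * γ ^ 2 * (‖b‖ ^ 2 - 2 * inner ℝ b G + ‖G‖ ^ 2) := by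
  have h1 : ‖a - G‖ ^ 2 ≤ 2 * ‖a - b‖ ^ 2 + 2 * ‖b - G‖ ^ 2 := by
    have h := norm_add_le (a - b) (b - G)
    rw [sub_add_sub_cancel] at h
    have := pow_le_pow_left₀ (norm_nonneg _) h 2
    nlinarith [sq_nonneg (‖a - b‖ - ‖b - G‖)]
  have h2 := norm_sub_sq_real b G
  have h3 := norm_sub_sq_real V (γ • (a - G))
  rw [norm_smul, mul_pow, Real.norm_eq_abs, sq_abs, inner_smul_right, inner_sub_right,
    real_inner_comm a V, real_inner_comm G V] at h3
  nlinarith [sq_nonneg γ, mul_le_mul_of_nonneg_left h1 (sq_nonneg γ)]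

/-- One gradient step, in mean square. -/
lemma lintegral_gradient_step_le (hφ : IsBase φ) (hc : IsStronglyConvex ell μ)
    (hH : HasAlmostConstantHessian ell H δ) {z : Vec d} (hz : IsMinOn ell Set.univ z)
    (lam lamStar : Param d) {γ : ℝ} (hγ : 0 ≤ γ) :
    ∫⁻ u, ENNReal.ofReal (‖lam - lamStar
        - γ • (reparamGrad ell lam u - meanGrad ell φ lamStar)‖ ^ 2) ∂(baseLaw d φ)
      ≤ ENNReal.ofReal ((1 - 2 * γ * μ + 2 * γ ^ 2 * (μ ^ 2 * gConst H δ μ φ))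
          * ‖lam - lamStar‖ ^ 2
        + 2 * γ ^ 2 * (μ ^ 2 * gConst H δ μ φ) * sigmaStar lamStar z ^ 2) := by
  have := hφ.isProbabilityMeasure_baseLaw (d := d)
  set V := lam - lamStar with hV
  set G := meanGrad ell φ lamStar with hG
  let B : (Fin d → ℝ) → ℝ := fun u =>
    ‖V‖ ^ 2 - 2 * γ * inner ℝ (reparamGrad ell lam u) V + 2 * γ * inner ℝ G V
      + 2 * γ ^ 2 * ‖reparamGrad ell lam u - reparamGrad ell lamStar u‖ ^ 2
      + 2 * γ ^ 2 * (‖reparamGrad ell lamStar u‖ ^ 2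
        - 2 * inner ℝ (reparamGrad ell lamStar u) G + ‖G‖ ^ 2)
  have hB : ∀ u, ‖V - γ • (reparamGrad ell lam u - G)‖ ^ 2 ≤ B u := fun u =>
    sq_norm_sub_smul_le V _ _ G γ
  have J1 := integrable_inner_reparamGrad hφ hc hH lam V
  have J2 := integrable_inner_reparamGrad hφ hc hH lamStar G
  have J3 := integrable_norm_sq_reparamGrad_sub hφ hH lam lamStar
  have J4 := integrable_norm_sq_reparamGrad hφ hc hH lamStar
  have K1 : Integrable (fun u => ‖V‖ ^ 2 - 2 * γ * inner ℝ (reparamGrad ell lam u) V)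
      (baseLaw d φ) := (integrable_const _).sub (J1.const_mul _)
  have K2 : Integrable (fun u => ‖V‖ ^ 2 - 2 * γ * inner ℝ (reparamGrad ell lam u) V
      + 2 * γ * inner ℝ G V) (baseLaw d φ) := K1.add (integrable_const _)
  have K3 : Integrable (fun u => ‖V‖ ^ 2 - 2 * γ * inner ℝ (reparamGrad ell lam u) V
      + 2 * γ * inner ℝ G V
      + 2 * γ ^ 2 * ‖reparamGrad ell lam u - reparamGrad ell lamStar u‖ ^ 2) (baseLaw d φ) :=
    K2.add (J3.const_mul _)
  have K4 : Integrable (fun u => ‖reparamGrad ell lamStar u‖ ^ 2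
        - 2 * inner ℝ (reparamGrad ell lamStar u) G) (baseLaw d φ) := J4.sub (J2.const_mul _)
  have K5 : Integrable (fun u => ‖reparamGrad ell lamStar u‖ ^ 2
        - 2 * inner ℝ (reparamGrad ell lamStar u) G + ‖G‖ ^ 2) (baseLaw d φ) :=
    K4.add (integrable_const _)
  have hBi : Integrable B (baseLaw d φ) := K3.add (K5.const_mul _)
  have hBint : ∫ u, B u ∂(baseLaw d φ)
      ≤ (1 - 2 * γ * μ + 2 * γ ^ 2 * (μ ^ 2 * gConst H δ μ φ)) * ‖V‖ ^ 2
        + 2 * γ ^ 2 * (μ ^ 2 * gConst H δ μ φ) * sigmaStar lamStar z ^ 2 := by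
    have e : ∫ u, B u ∂(baseLaw d φ) = ‖V‖ ^ 2 - 2 * γ * inner ℝ (meanGrad ell φ lam) V
        + 2 * γ * inner ℝ G V
        + 2 * γ ^ 2 * (∫ u, ‖reparamGrad ell lam u - reparamGrad ell lamStar u‖ ^ 2
            ∂(baseLaw d φ))
        + 2 * γ ^ 2 * ((∫ u, ‖reparamGrad ell lamStar u‖ ^ 2 ∂(baseLaw d φ))
          - 2 * inner ℝ G G + ‖G‖ ^ 2) := by
      simp only [B]
      rw [integral_add K3 (K5.const_mul _), integral_add K2 (J3.const_mul _),
        integral_add K1 (integrable_const _), integral_sub (integrable_const _) (J1.const_mul _),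
        integral_const_mul, integral_const_mul, integral_const_mul, integral_const_mul,
        integral_add K4 (integrable_const _), integral_sub J4 (J2.const_mul _),
        integral_const_mul, integral_inner_reparamGrad hφ hc hH,
        integral_inner_reparamGrad hφ hc hH]
      simp only [integral_const, probReal_univ, smul_eq_mul, one_mul, hG]
    rw [e, real_inner_self_eq_norm_sq]
    have h1 := meanGrad_strongly_monotone hφ hc hH lam lamStar
    rw [inner_sub_left] at h1
    have h2 := integral_norm_sq_reparamGrad_sub_le hφ hc.1 hH lam lamStar
    have h3 := integral_norm_sq_reparamGrad_le hφ hc hH hz lamStar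
    have hγ2 : 0 ≤ 2 * γ ^ 2 := by positivity
    have m1 := mul_le_mul_of_nonneg_left h1 (show 0 ≤ 2 * γ by positivity)
    have m2 := mul_le_mul_of_nonneg_left h2 hγ2
    have m3 := mul_le_mul_of_nonneg_left h3 hγ2
    -- The contribution `-2‖G‖² + ‖G‖²` is negative and is dropped: the variance is bounded by the
    -- second moment.
    have m4 : 0 ≤ 2 * γ ^ 2 * ‖G‖ ^ 2 := by positivity
    rw [← hV] at m1 m2
    rw [← hG] at m1
    linarith
  calc ∫⁻ u, ENNReal.ofReal (‖V - γ • (reparamGrad ell lam u - G)‖ ^ 2) ∂(baseLaw d φ)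
      ≤ ∫⁻ u, ENNReal.ofReal (B u) ∂(baseLaw d φ) :=
        lintegral_mono fun u => ENNReal.ofReal_le_ofReal (hB u)
    _ = ENNReal.ofReal (∫ u, B u ∂(baseLaw d φ)) :=
        (ofReal_integral_eq_lintegral_ofReal hBi
          (ae_of_all _ fun u => (sq_nonneg _).trans (hB u))).symm
    _ ≤ _ := ENNReal.ofReal_le_ofReal hBint

end Estimator

/-! ### The energy -/

section Energy

variable {d : ℕ} {φ : Measure ℝ} {ell : Vec d → ℝ} {μ δ : ℝ} {H : Matrix (Fin d) (Fin d) ℝ}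

lemma energy_eq (hd : Differentiable ℝ ell) (φ : Measure ℝ) (lam : Param d) :
    energy ell φ lam = ∫ u, ell (reparam lam u) ∂(baseLaw d φ) :=
  integral_map (reparamMeasurable lam).aemeasurable hd.continuous.aestronglyMeasurable
where
  reparamMeasurable (lam : Param d) : Measurable (reparam lam) :=
    (continuous_reparam.comp (Continuous.prodMk_right lam)).measurable

lemma integrable_ell_reparam (hφ : IsBase φ) (hc : IsStronglyConvex ell μ)
    (hH : HasAlmostConstantHessian ell H δ) (lam : Param d) :
    Integrable (fun u => ell (reparam lam u)) (baseLaw d φ) := by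
  have := hφ.isProbabilityMeasure_baseLaw (d := d)
  obtain ⟨z, hz, _⟩ := existsUnique_minimizer hc
  refine ((integrable_const |ell z|).add ((hφ.integrable_norm_sq_reparam
    (lam - pointMass z)).const_mul (smoothness H δ))).mono'
    (hc.2.1.continuous.comp (continuous_reparam.comp
      (Continuous.prodMk_right lam))).aestronglyMeasurable (ae_of_all _ fun u => ?_)
  have h1 := hz (Set.mem_univ (reparam lam u))
  have h2 := upper_bound hc hH z (reparam lam u)
  rw [gradient_eq_zero_of_isMinOn hz, inner_zero_left] at h2
  simp only [Set.mem_ofPred_eq, Pi.add_apply, reparam_sub, reparam_pointMass] at h1 ⊢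
  have h3 : 0 ≤ smoothness H δ * ‖reparam lam u - z‖ ^ 2 :=
    mul_nonneg (smoothness_nonneg hH) (sq_nonneg _)
  rw [Real.norm_eq_abs, abs_le]
  constructor
  · linarith [neg_abs_le (ell z)]
  · linarith [le_abs_self (ell z)]

lemma energy_le (hφ : IsBase φ) (hc : IsStronglyConvex ell μ)
    (hH : HasAlmostConstantHessian ell H δ) (lam lam' : Param d) :
    energy ell φ lam' ≤ energy ell φ lam + inner ℝ (meanGrad ell φ lam) (lam' - lam)
      + smoothness H δ * ‖lam' - lam‖ ^ 2 := by
  have I1 := integrable_ell_reparam hφ hc hH lam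
  have I2 := integrable_inner_reparamGrad hφ hc hH lam (lam' - lam)
  have I12 : Integrable (fun u => ell (reparam lam u)
      + inner ℝ (reparamGrad ell lam u) (lam' - lam)) (baseLaw d φ) := I1.add I2
  have I3 := (hφ.integrable_norm_sq_reparam (lam' - lam)).const_mul (smoothness H δ)
  rw [energy_eq hc.2.1, energy_eq hc.2.1, ← integral_inner_reparamGrad hφ hc hH,
    ← hφ.integral_norm_sq_reparam (lam' - lam), ← integral_const_mul, ← integral_add I1 I2,
    ← integral_add I12 I3]
  refine integral_mono (integrable_ell_reparam hφ hc hH lam') (I12.add I3) fun u => ?_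
  simp only
  rw [inner_reparamGrad hc.2.1, reparam_sub]
  exact upper_bound hc hH _ _

lemma le_energy (hφ : IsBase φ) (hc : IsStronglyConvex ell μ)
    (hH : HasAlmostConstantHessian ell H δ) (lam lam' : Param d) :
    energy ell φ lam + inner ℝ (meanGrad ell φ lam) (lam' - lam) + μ / 2 * ‖lam' - lam‖ ^ 2
      ≤ energy ell φ lam' := by
  have I1 := integrable_ell_reparam hφ hc hH lam
  have I2 := integrable_inner_reparamGrad hφ hc hH lam (lam' - lam)
  have I12 : Integrable (fun u => ell (reparam lam u)
      + inner ℝ (reparamGrad ell lam u) (lam' - lam)) (baseLaw d φ) := I1.add I2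
  have I3 := (hφ.integrable_norm_sq_reparam (lam' - lam)).const_mul (μ / 2)
  rw [energy_eq hc.2.1, energy_eq hc.2.1, ← integral_inner_reparamGrad hφ hc hH,
    ← hφ.integral_norm_sq_reparam (lam' - lam), ← integral_const_mul, ← integral_add I1 I2,
    ← integral_add I12 I3]
  refine integral_mono (I12.add I3) (integrable_ell_reparam hφ hc hH lam') fun u => ?_
  simp only
  rw [inner_reparamGrad hc.2.1, reparam_sub]
  exact lower_bound hc _ _

/-- At each point the energy is squeezed between two quadratics that touch it there. -/
lemma continuous_energy (hφ : IsBase φ) (hc : IsStronglyConvex ell μ)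
    (hH : HasAlmostConstantHessian ell H δ) : Continuous (energy ell φ) := by
  rw [continuous_iff_continuousAt]
  intro lam
  have hlow : Tendsto (fun x => energy ell φ lam + inner ℝ (meanGrad ell φ lam) (x - lam)
      + μ / 2 * ‖x - lam‖ ^ 2) (𝓝 lam) (𝓝 (energy ell φ lam)) := by
    have h : Continuous fun x => energy ell φ lam + inner ℝ (meanGrad ell φ lam) (x - lam)
      + μ / 2 * ‖x - lam‖ ^ 2 := by fun_prop
    simpa using h.tendsto lam
  have hup : Tendsto (fun x => energy ell φ lam + inner ℝ (meanGrad ell φ lam) (x - lam)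
      + smoothness H δ * ‖x - lam‖ ^ 2) (𝓝 lam) (𝓝 (energy ell φ lam)) := by
    have h : Continuous fun x => energy ell φ lam + inner ℝ (meanGrad ell φ lam) (x - lam)
      + smoothness H δ * ‖x - lam‖ ^ 2 := by fun_prop
    simpa using h.tendsto lam
  exact tendsto_of_tendsto_of_tendsto_of_le_of_le hlow hup
    (fun x => le_energy hφ hc hH lam x) (fun x => energy_le hφ hc hH lam x)

end Energy

/-! ### Minimizing a regularizer plus a smooth function -/

section Regularizer

variable {d : ℕ} {h : Param d → EReal}

lemma paramSet_combo {x y : Param d} (hx : x ∈ paramSet d) (hy : y ∈ paramSet d) {a b : ℝ}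
    (ha : 0 < a) (hb : 0 < b) : a • x + b • y ∈ paramSet d := fun i => by
  rw [scale_add, scale_smul, scale_smul]
  exact add_pos (mul_pos ha (hx i)) (mul_pos hb (hy i))

lemma IsRegularizer.coe_toReal (hh : IsRegularizer h) {x : Param d} (hx : x ∈ paramSet d)
    (hx' : h x ≠ ⊤) : ((h x).toReal : EReal) = h x :=
  EReal.coe_toReal hx' (hh.ne_bot x hx)

lemma IsRegularizer.segment_le (hh : IsRegularizer h) {x y : Param d} (hx : x ∈ paramSet d)
    (hy : y ∈ paramSet d) (hx' : h x ≠ ⊤) (hy' : h y ≠ ⊤) {s : ℝ} (hs : 0 < s) (hs1 : s < 1) :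
    h (y + s • (x - y)) ≤ (((1 - s) * (h y).toReal + s * (h x).toReal : ℝ) : EReal) := by
  have e : y + s • (x - y) = (1 - s) • y + s • x := by
    rw [smul_sub, sub_smul, one_smul]; abel
  rw [e, EReal.coe_add, EReal.coe_mul, EReal.coe_mul, hh.coe_toReal hx hx',
    hh.coe_toReal hy hy']
  exact hh.convex y hy x hx (1 - s) s (by linarith) hs (by ring)

lemma paramSet_segment {x y : Param d} (hx : x ∈ paramSet d) (hy : y ∈ paramSet d) {s : ℝ}
    (hs : 0 < s) (hs1 : s < 1) : y + s • (x - y) ∈ paramSet d := by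
  have e : y + s • (x - y) = (1 - s) • y + s • x := by
    rw [smul_sub, sub_smul, one_smul]; abel
  rw [e]
  exact paramSet_combo hy hx (by linarith) hs

lemma IsRegularizer.ne_top_of_min (hh : IsRegularizer h) {q : Param d → ℝ} {y : Param d}
    (hmin : ∀ x ∈ paramSet d, h y + (q y : EReal) ≤ h x + (q x : EReal)) : h y ≠ ⊤ := by
  intro htop
  obtain ⟨x, hx, hx'⟩ := hh.proper
  have h1 := hmin x hx
  rw [htop, EReal.top_add_coe, top_le_iff, ← hh.coe_toReal hx hx', ← EReal.coe_add] at h1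
  exact EReal.coe_ne_top _ h1

/-- The first-order optimality condition for `h + q` over `Λ`. -/
lemma IsRegularizer.variational_inequality (hh : IsRegularizer h) {q : Param d → ℝ}
    {y G : Param d} {K : ℝ} (hy : y ∈ paramSet d)
    (hmin : ∀ x ∈ paramSet d, h y + (q y : EReal) ≤ h x + (q x : EReal))
    (hq : ∀ x, q x ≤ q y + inner ℝ G (x - y) + K * ‖x - y‖ ^ 2)
    {x : Param d} (hx : x ∈ paramSet d) (hx' : h x ≠ ⊤) :
    (h y).toReal ≤ (h x).toReal + inner ℝ G (x - y) := by
  have hy' := hh.ne_top_of_min hmin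
  set N := K * ‖x - y‖ ^ 2 with hN
  -- Compare `y` with the point at fraction `s` of the segment towards `x` and divide by `s`; the
  -- quadratic error is then `s * N`, which vanishes as `s → 0`.
  have key : ∀ s : ℝ, 0 < s → s < 1 →
      (h y).toReal ≤ (h x).toReal + inner ℝ G (x - y) + s * N := by
    intro s hs hs1
    have h1 := hmin _ (paramSet_segment hx hy hs hs1)
    have h2 := hh.segment_le hx hy hx' hy' hs hs1
    have h3 := h1.trans (add_le_add_left h2 _)
    rw [← hh.coe_toReal hy hy', ← EReal.coe_add, ← EReal.coe_add, EReal.coe_le_coe_iff,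
      hh.coe_toReal hy hy'] at h3
    have h4 := hq (y + s • (x - y))
    rw [add_sub_cancel_left, inner_smul_right, norm_smul, mul_pow, Real.norm_eq_abs,
      sq_abs] at h4
    have h5 : s * (h y).toReal ≤ s * ((h x).toReal + inner ℝ G (x - y) + s * N) := by
      rw [hN]; linarith
    exact le_of_mul_le_mul_left h5 hs
  have ht : Tendsto (fun s : ℝ => (h x).toReal + inner ℝ G (x - y) + s * N) (𝓝[>] 0)
      (𝓝 ((h x).toReal + inner ℝ G (x - y) + 0 * N)) :=
    ((continuous_const.add (continuous_id.mul continuous_const)).tendsto _).mono_left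
      nhdsWithin_le_nhds
  rw [zero_mul, add_zero] at ht
  refine ge_of_tendsto ht ?_
  filter_upwards [Ioo_mem_nhdsGT (zero_lt_one (α := ℝ))] with s hs using key s hs.1 hs.2

/-- Semicontinuity at `x₀` gives `h > h(x₀) - 1` on a relative ball of radius `r`. For `x` farther
away, convexity is applied at the point of the segment at distance `r/2` from `x₀`, so `h` cannot
fall faster than slope `2/r`. -/
lemma IsRegularizer.exists_linear_minorant (hh : IsRegularizer h) {x₀ : Param d}
    (hx₀ : x₀ ∈ paramSet d) (hx₀' : h x₀ ≠ ⊤) :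
    ∃ A B : ℝ, ∀ x ∈ paramSet d, ((A - B * ‖x - x₀‖ : ℝ) : EReal) ≤ h x := by
  set A := (h x₀).toReal - 1 with hA
  have hlt : (A : EReal) < h x₀ := by
    rw [← hh.coe_toReal hx₀ hx₀', EReal.coe_lt_coe_iff]; linarith
  have hev := lowerSemicontinuousWithinAt_iff.1 (hh.lsc x₀ hx₀) _ hlt
  obtain ⟨r, hr, hball⟩ := Metric.mem_nhdsWithin_iff.1 hev
  refine ⟨A, 2 / r, fun x hx => ?_⟩
  rcases lt_or_ge ‖x - x₀‖ r with hxr | hxr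
  · have h1 : (A : EReal) < h x := hball ⟨by rwa [Metric.mem_ball, dist_eq_norm], hx⟩
    refine le_trans (EReal.coe_le_coe_iff.2 ?_) h1.le
    have : 0 ≤ 2 / r * ‖x - x₀‖ := by positivity
    linarith
  · by_cases hx' : h x = ⊤
    · rw [hx']; exact le_top
    have hn : 0 < ‖x - x₀‖ := hr.trans_le hxr
    set s := r / (2 * ‖x - x₀‖) with hs
    have hs0 : 0 < s := by positivity
    have hs1 : s < 1 := by rw [hs, div_lt_one (by positivity)]; linarith
    have hmem : x₀ + s • (x - x₀) ∈ Metric.ball x₀ r := by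
      rw [Metric.mem_ball, dist_eq_norm, add_sub_cancel_left, norm_smul, Real.norm_of_nonneg hs0.le]
      have : s * ‖x - x₀‖ = r / 2 := by rw [hs]; field_simp
      linarith
    have h1 : (A : EReal) < h (x₀ + s • (x - x₀)) :=
      hball ⟨hmem, paramSet_segment hx hx₀ hs0 hs1⟩
    have h2 := h1.trans_le (hh.segment_le hx hx₀ hx' hx₀' hs0 hs1)
    rw [EReal.coe_lt_coe_iff] at h2
    rw [← hh.coe_toReal hx hx', EReal.coe_le_coe_iff]
    have h3 : s * (2 / r * ‖x - x₀‖) = 1 := by rw [hs]; field_simp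
    have h4 : s * (A - 2 / r * ‖x - x₀‖) ≤ s * (h x).toReal := by
      rw [mul_sub, h3]
      nlinarith
    exact le_of_mul_le_mul_left h4 hs0

/-- Quadratic growth of `q` beats the linear minorant of `h`, so a compact ball suffices. Closedness
of `h` prevents the minimum from escaping to the boundary of `Λ`: the extension by `⊤` attains its
minimum with a finite value, hence inside `Λ`. -/
lemma IsRegularizer.exists_minimizer (hh : IsRegularizer h) (hcl : IsClosedRegularizer h)
    {q : Param d → ℝ} (hq : Continuous q)
    (hcoer : ∀ x₀ : Param d, ∃ a b m : ℝ, 0 < m ∧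
      ∀ x, a - b * ‖x - x₀‖ + m * ‖x - x₀‖ ^ 2 ≤ q x) :
    ∃ y ∈ paramSet d, ∀ x ∈ paramSet d, h y + (q y : EReal) ≤ h x + (q x : EReal) := by
  classical
  obtain ⟨x₀, hx₀, hx₀'⟩ := hh.proper
  obtain ⟨A, B, hAB⟩ := hh.exists_linear_minorant hx₀ hx₀'
  obtain ⟨a, b, m, hm, hqm⟩ := hcoer x₀
  obtain ⟨R, hR⟩ := ((tendsto_quadratic_atTop (a := A + a) (b := B + b) hm).eventually_ge_atTop
    ((h x₀).toReal + q x₀)).exists_forall_of_atTop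
  let Φ : Param d → EReal := fun x => (if x ∈ paramSet d then h x else ⊤) + (q x : EReal)
  have hΦ : LowerSemicontinuous Φ := by
    refine LowerSemicontinuous.add' ?_
      (continuous_coe_real_ereal.comp hq).lowerSemicontinuous fun x =>
        EReal.continuousAt_add (Or.inr (EReal.coe_ne_bot _)) (Or.inr (EReal.coe_ne_top _))
    unfold IsClosedRegularizer at hcl
    convert hcl
  have hΦin : ∀ x ∈ paramSet d, Φ x = h x + (q x : EReal) := fun x hx => by simp [Φ, hx]
  obtain ⟨y, hyball, hymin⟩ := (hΦ.lowerSemicontinuousOn _).exists_isMinOn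
    (s := Metric.closedBall x₀ (max R 0)) ⟨x₀, Metric.mem_closedBall_self (le_max_right _ _)⟩
    (isCompact_closedBall _ _)
  have hy0 : Φ y ≤ Φ x₀ := hymin (Metric.mem_closedBall_self (le_max_right _ _))
  have hx₀val : Φ x₀ = (((h x₀).toReal + q x₀ : ℝ) : EReal) := by
    rw [hΦin x₀ hx₀, EReal.coe_add, hh.coe_toReal hx₀ hx₀']
  have hy : y ∈ paramSet d := by
    by_contra hny
    have : Φ y = ⊤ := by simp [Φ, hny]
    rw [this, hx₀val, top_le_iff] at hy0
    exact EReal.coe_ne_top _ hy0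
  refine ⟨y, hy, fun x hx => ?_⟩
  rw [← hΦin y hy, ← hΦin x hx]
  by_cases hxb : x ∈ Metric.closedBall x₀ (max R 0)
  · exact hymin hxb
  · refine hy0.trans ?_
    rw [Metric.mem_closedBall, not_le, dist_eq_norm] at hxb
    have h1 := hR ‖x - x₀‖ ((le_max_left _ _).trans hxb.le)
    rw [hx₀val, hΦin x hx]
    refine le_trans (EReal.coe_le_coe_iff.2 h1) ?_
    refine le_trans ?_ (add_le_add (hAB x hx) (EReal.coe_le_coe_iff.2 (hqm x)))
    rw [← EReal.coe_add, EReal.coe_le_coe_iff]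
    linarith

end Regularizer

/-! ### The optimum and the proximal operator -/

section Optimum

variable {d : ℕ} {φ : Measure ℝ} {ell : Vec d → ℝ} {μ δ : ℝ} {H : Matrix (Fin d) (Fin d) ℝ}
  {h : Param d → EReal}

lemma isOptimum_iff {lam : Param d} : IsOptimum ell φ h lam ↔ lam ∈ paramSet d ∧
    ∀ x ∈ paramSet d, h lam + (energy ell φ lam : EReal) ≤ h x + (energy ell φ x : EReal) := by
  simp only [IsOptimum, isMinOn_iff, objective, add_comm]

lemma isProx_iff {γ : ℝ} {x y : Param d} : IsProx h γ x y ↔ y ∈ paramSet d ∧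
    ∀ y' ∈ paramSet d, h y + ((1 / (2 * γ) * ‖x - y‖ ^ 2 : ℝ) : EReal)
      ≤ h y' + ((1 / (2 * γ) * ‖x - y'‖ ^ 2 : ℝ) : EReal) := by
  simp only [IsProx, isMinOn_iff]

lemma IsOptimum.ne_top (hh : IsRegularizer h) {lam : Param d} (ho : IsOptimum ell φ h lam) :
    h lam ≠ ⊤ :=
  hh.ne_top_of_min (q := energy ell φ) (isOptimum_iff.1 ho).2

lemma IsOptimum.variational_inequality (hφ : IsBase φ) (hc : IsStronglyConvex ell μ)
    (hH : HasAlmostConstantHessian ell H δ) (hh : IsRegularizer h) {lam : Param d}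
    (ho : IsOptimum ell φ h lam) {x : Param d} (hx : x ∈ paramSet d) (hx' : h x ≠ ⊤) :
    (h lam).toReal ≤ (h x).toReal + inner ℝ (meanGrad ell φ lam) (x - lam) :=
  hh.variational_inequality ho.1 (isOptimum_iff.1 ho).2 (energy_le hφ hc hH lam) hx hx'

lemma half_sq_expand (γ : ℝ) (x y y' : Param d) :
    1 / (2 * γ) * ‖x - y'‖ ^ 2 = 1 / (2 * γ) * ‖x - y‖ ^ 2
      + inner ℝ ((1 / γ) • (y - x)) (y' - y) + 1 / (2 * γ) * ‖y' - y‖ ^ 2 := by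
  have e : x - y' = (x - y) - (y' - y) := by abel
  rw [e, norm_sub_sq_real (x - y) (y' - y), inner_smul_left, ← neg_sub x y, inner_neg_left]
  simp only [conj_trivial]
  ring

lemma IsProx.ne_top (hh : IsRegularizer h) {γ : ℝ} {x y : Param d} (hp : IsProx h γ x y) :
    h y ≠ ⊤ :=
  hh.ne_top_of_min (q := fun y' => 1 / (2 * γ) * ‖x - y'‖ ^ 2) (isProx_iff.1 hp).2

lemma IsProx.variational_inequality (hh : IsRegularizer h) {γ : ℝ} {x y : Param d}
    (hp : IsProx h γ x y) {x' : Param d} (hx : x' ∈ paramSet d) (hx' : h x' ≠ ⊤) :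
    (h y).toReal ≤ (h x').toReal + inner ℝ ((1 / γ) • (y - x)) (x' - y) :=
  hh.variational_inequality (q := fun y' => 1 / (2 * γ) * ‖x - y'‖ ^ 2) hp.1 (isProx_iff.1 hp).2
    (fun y' => (half_sq_expand γ x y y').le) hx hx'

/-- Adding the inequalities cancels `Y₁` and `Y₂` and leaves `‖y₁ - y₂‖² ≤ ⟪x₁ - x₂, y₁ - y₂⟫`;
Cauchy–Schwarz finishes. Only the variational inequalities enter, so the optimum can play the role
of one proximal point. -/
lemma norm_sub_le_of_resolvent {γ Y₁ Y₂ : ℝ} (hγ : 0 < γ) {x₁ x₂ y₁ y₂ : Param d}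
    (h₁ : Y₁ ≤ Y₂ + inner ℝ ((1 / γ) • (y₁ - x₁)) (y₂ - y₁))
    (h₂ : Y₂ ≤ Y₁ + inner ℝ ((1 / γ) • (y₂ - x₂)) (y₁ - y₂)) :
    ‖y₁ - y₂‖ ≤ ‖x₁ - x₂‖ := by
  rw [inner_smul_left, conj_trivial] at h₁ h₂
  have h3 : 0 ≤ 1 / γ * (inner ℝ (y₁ - x₁) (y₂ - y₁) + inner ℝ (y₂ - x₂) (y₁ - y₂)) := by
    linarith
  have h4 : 0 ≤ inner ℝ (y₁ - x₁) (y₂ - y₁) + inner ℝ (y₂ - x₂) (y₁ - y₂) :=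
    nonneg_of_mul_nonneg_right h3 (by positivity)
  have h5 : inner ℝ (y₁ - x₁) (y₂ - y₁) + inner ℝ (y₂ - x₂) (y₁ - y₂)
      = inner ℝ (x₁ - x₂) (y₁ - y₂) - ‖y₁ - y₂‖ ^ 2 := by
    rw [← real_inner_self_eq_norm_sq, ← neg_sub y₁ y₂, inner_neg_right, ← inner_neg_left,
      ← inner_add_left, ← inner_sub_left]
    congr 1
    abel
  have h6 := real_inner_le_norm (x₁ - x₂) (y₁ - y₂)
  by_contra hcon
  push Not at hcon
  have h7 : 0 < ‖y₁ - y₂‖ := (norm_nonneg _).trans_lt hcon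
  nlinarith

lemma IsProx.norm_sub_le (hh : IsRegularizer h) {γ : ℝ} (hγ : 0 < γ) {x₁ x₂ y₁ y₂ : Param d}
    (h₁ : IsProx h γ x₁ y₁) (h₂ : IsProx h γ x₂ y₂) : ‖y₁ - y₂‖ ≤ ‖x₁ - x₂‖ :=
  norm_sub_le_of_resolvent hγ (h₁.variational_inequality hh h₂.1 (h₂.ne_top hh))
    (h₂.variational_inequality hh h₁.1 (h₁.ne_top hh))

/-- The first-order condition at the optimum is the variational inequality of the proximal map at
`λ_* - γ ∇f(λ_*)`. -/
lemma IsProx.norm_sub_optimum_le (hφ : IsBase φ) (hc : IsStronglyConvex ell μ)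
    (hH : HasAlmostConstantHessian ell H δ) (hh : IsRegularizer h) {γ : ℝ} (hγ : 0 < γ)
    {x y lamStar : Param d} (hp : IsProx h γ x y) (ho : IsOptimum ell φ h lamStar) :
    ‖y - lamStar‖ ≤ ‖x - (lamStar - γ • meanGrad ell φ lamStar)‖ := by
  refine norm_sub_le_of_resolvent hγ
    (hp.variational_inequality hh ho.1 (ho.ne_top hh)) ?_
  rw [sub_sub_cancel, smul_smul, one_div_mul_cancel hγ.ne', one_smul]
  exact ho.variational_inequality hφ hc hH hh hp.1 (hp.ne_top hh)

lemma existsUnique_isOptimum (hφ : IsBase φ) (hc : IsStronglyConvex ell μ)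
    (hH : HasAlmostConstantHessian ell H δ) (hh : IsRegularizer h)
    (hcl : IsClosedRegularizer h) : ∃! lam : Param d, IsOptimum ell φ h lam := by
  obtain ⟨y, hy, hmin⟩ := hh.exists_minimizer hcl (continuous_energy hφ hc hH) fun x₀ =>
    ⟨energy ell φ x₀, ‖meanGrad ell φ x₀‖, μ / 2, half_pos hc.1, fun x => by
      have h1 := le_energy hφ hc hH x₀ x
      have h2 := neg_le_of_abs_le (abs_real_inner_le_norm (meanGrad ell φ x₀) (x - x₀))
      linarith⟩
  have ho : IsOptimum ell φ h y := isOptimum_iff.2 ⟨hy, hmin⟩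
  refine ⟨y, ho, fun y' ho' => ?_⟩
  have h1 := ho.variational_inequality hφ hc hH hh ho'.1 (ho'.ne_top hh)
  have h2 := ho'.variational_inequality hφ hc hH hh ho.1 (ho.ne_top hh)
  have h3 := meanGrad_strongly_monotone hφ hc hH y' y
  rw [← neg_sub y' y, inner_neg_right] at h2
  rw [inner_sub_left] at h3
  have h4 : μ * ‖y' - y‖ ^ 2 ≤ 0 := by linarith
  have h5 : ‖y' - y‖ ^ 2 ≤ 0 := by
    by_contra hcon
    push Not at hcon
    exact absurd h4 (not_le.2 (mul_pos hc.1 hcon))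
  have h6 : ‖y' - y‖ = 0 := by nlinarith [norm_nonneg (y' - y)]
  exact sub_eq_zero.1 (norm_eq_zero.1 h6)

lemma existsUnique_isProx (hh : IsRegularizer h) (hcl : IsClosedRegularizer h) {γ : ℝ}
    (hγ : 0 < γ) (x : Param d) : ∃! y : Param d, IsProx h γ x y := by
  obtain ⟨y, hy, hmin⟩ := hh.exists_minimizer hcl
    (q := fun y' => 1 / (2 * γ) * ‖x - y'‖ ^ 2) (by fun_prop) fun x₀ =>
    ⟨1 / (2 * γ) * ‖x - x₀‖ ^ 2, ‖(1 / γ) • (x₀ - x)‖, 1 / (2 * γ), by positivity, fun y' => by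
      rw [half_sq_expand γ x x₀ y']
      have h2 := neg_le_of_abs_le (abs_real_inner_le_norm ((1 / γ) • (x₀ - x)) (y' - x₀))
      linarith⟩
  have hp : IsProx h γ x y := isProx_iff.2 ⟨hy, hmin⟩
  refine ⟨y, hp, fun y' hp' => ?_⟩
  have := hp'.norm_sub_le hh hγ hp
  rw [sub_self, norm_zero] at this
  exact sub_eq_zero.1 (norm_le_zero_iff.1 this)

/-- The proximal operator, wherever it is defined, is given by a continuous map. -/
lemma exists_continuous_prox (hh : IsRegularizer h) {γ : ℝ} (hγ : 0 < γ) :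
    ∃ p : Param d → Param d, Continuous p ∧ ∀ x y, IsProx h γ x y → y = p x := by
  classical
  let p₀ : Param d → Param d := fun x => if hx : ∃ y, IsProx h γ x y then hx.choose else 0
  have hp₀ : ∀ x, (∃ y, IsProx h γ x y) → IsProx h γ x (p₀ x) := fun x hx => by
    simp only [p₀, hx, dite_true]
    exact hx.choose_spec
  have hlip : LipschitzOnWith 1 p₀ {x | ∃ y, IsProx h γ x y} :=
    LipschitzOnWith.of_dist_le_mul fun x hx x' hx' => by
      rw [NNReal.coe_one, one_mul, dist_eq_norm, dist_eq_norm]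
      exact (hp₀ x hx).norm_sub_le hh hγ (hp₀ x' hx')
  -- When `h` is not closed the proximal point may fail to exist for some `x`. Extending the
  -- nonexpansive map off its domain may worsen the constant, but only continuity is used.
  obtain ⟨p, hp, heq⟩ := hlip.extend_finite_dimension
  refine ⟨p, hp.continuous, fun x y hy => ?_⟩
  rw [← heq ⟨y, hy⟩]
  have := hy.norm_sub_le hh hγ (hp₀ x ⟨y, hy⟩)
  rw [sub_self, norm_zero] at this
  exact sub_eq_zero.1 (norm_le_zero_iff.1 this)

end Optimum

/-! ### Solving the recursion of the two-stage schedule -/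

/-- The value `b` is the fixed point of the recursion, and `1 - a ≤ exp (-a)` controls the
transient. -/
lemma geometric_recursion_le {r : ℕ → ℝ} {a b : ℝ} (ha1 : a ≤ 1) (hb : 0 ≤ b) {N : ℕ}
    (h : ∀ t < N, r (t + 1) ≤ (1 - a) * r t + a * b) (hr : 0 ≤ r 0) :
    ∀ t ≤ N, r t ≤ Real.exp (-(a * t)) * r 0 + b := by
  intro t
  induction t with
  | zero => intro _; simp [hb]
  | succ t ih =>
    intro ht
    have h1 := h t (by omega)
    have h2 := mul_le_mul_of_nonneg_left (ih (by omega)) (sub_nonneg.2 ha1)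
    have h3 : 1 - a ≤ Real.exp (-a) := by have := Real.add_one_le_exp (-a); linarith
    have h4 : Real.exp (-(a * (t + 1 : ℕ))) = Real.exp (-a) * Real.exp (-(a * t)) := by
      rw [← Real.exp_add]; congr 1; push_cast; ring
    have h5 := mul_le_mul_of_nonneg_right h3 (mul_nonneg (Real.exp_pos (-(a * t))).le hr)
    rw [h4]
    nlinarith

/-- The step is chosen so that `1 - (2t+1)/(t+1)² = t²/(t+1)²`. Multiplying by `(t+1)²` telescopes
`t² r_t`, with increments at most `4b`. -/
lemma harmonic_recursion_le {r : ℕ → ℝ} {b : ℝ} (hb : 0 ≤ b) {N : ℕ}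
    (h : ∀ t : ℕ, N ≤ t → r (t + 1) ≤ (1 - (2 * t + 1) / ((t : ℝ) + 1) ^ 2) * r t
      + ((2 * t + 1) / ((t : ℝ) + 1) ^ 2) ^ 2 * b) :
    ∀ t, N ≤ t → (t : ℝ) ^ 2 * r t ≤ (N : ℝ) ^ 2 * r N + 4 * b * t := by
  intro t ht
  induction t, ht using Nat.le_induction with
  | base => have : 0 ≤ 4 * b * N := by positivity
            linarith
  | succ t ht ih =>
    have h1 := h t ht
    have hp : (0 : ℝ) < (t : ℝ) + 1 := by positivity
    have h2 := mul_le_mul_of_nonneg_left h1 (sq_nonneg ((t : ℝ) + 1))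
    have h3 : ((t : ℝ) + 1) ^ 2 * ((1 - (2 * t + 1) / ((t : ℝ) + 1) ^ 2) * r t
      + ((2 * t + 1) / ((t : ℝ) + 1) ^ 2) ^ 2 * b)
        = (t : ℝ) ^ 2 * r t + ((2 * t + 1) / ((t : ℝ) + 1)) ^ 2 * b := by
      field_simp
      ring
    have h4 : (2 * t + 1) / ((t : ℝ) + 1) ≤ 2 := by
      rw [div_le_iff₀ hp]; linarith
    have h5 : ((2 * t + 1) / ((t : ℝ) + 1)) ^ 2 ≤ 2 ^ 2 := pow_le_pow_left₀ (by positivity) h4 2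
    have h6 := mul_le_mul_of_nonneg_right h5 hb
    push_cast
    nlinarith

/-- The index `t_*` of the last step of the first stage. -/
def switchTime (g L : ℝ) : ℕ := ⌈4 * g + 2 * g * L⌉₊

/-- In the first stage `γ₀ μ = 1/(2g)` and the noise floor is `σ²`. The part `2gL` of the switch
time damps `r 0` down to `σ²`; the part `4g` makes every later step at most `γ₀`, through
`(2t+1)/(t+1)² ≤ 2/(t+1) ≤ 1/(2g)`. The second stage is governed by `s = σ/√ε`. -/
lemma two_stage_recursion {r : ℕ → ℝ} {μ g σ : ℝ} (hμ : 0 < μ) (hg : 2 ≤ g) (hσ : 0 < σ)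
    (hr : 0 ≤ r 0)
    (h : ∀ γ : ℝ, ∀ t, γ = stepSize μ (μ / (2 * (μ ^ 2 * g)))
        (switchTime g (Real.posLog (r 0 / σ ^ 2))) t →
      γ ≤ μ / (2 * (μ ^ 2 * g)) →
      r (t + 1) ≤ (1 - γ * μ) * r t + 2 * γ ^ 2 * (μ ^ 2 * g) * σ ^ 2)
    {ε : ℝ} (hε : 0 < ε) {T : ℕ}
    (hT : 32 * (g * (σ ^ 2 / ε + σ * Real.posLog (r 0 / σ ^ 2) / Real.sqrt ε
      + Real.posLog (r 0 / ε) + 1)) ≤ (T : ℝ)) :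
    r T ≤ ε := by
  set L := Real.posLog (r 0 / σ ^ 2) with hL
  set N := switchTime g L with hN
  have hL0 : 0 ≤ L := Real.posLog_nonneg
  have hE0 : 0 ≤ Real.posLog (r 0 / ε) := Real.posLog_nonneg
  have hg0 : 0 < g := by linarith
  have hN1 : 4 * g + 2 * g * L ≤ N := Nat.le_ceil _
  have hN2 : (N : ℝ) + 1 ≤ 5 * g + 2 * g * L := by
    have := Nat.ceil_lt_add_one (a := 4 * g + 2 * g * L) (by positivity)
    have h2 : (N : ℝ) < 4 * g + 2 * g * L + 1 := this
    linarith
  set s := σ / Real.sqrt ε with hs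
  have hse : 0 < Real.sqrt ε := Real.sqrt_pos.2 hε
  have hs0 : 0 < s := div_pos hσ hse
  have hs2 : σ ^ 2 / ε = s ^ 2 := by rw [hs, div_pow, Real.sq_sqrt hε.le]
  have hσs : σ ^ 2 = s ^ 2 * ε := by rw [← hs2]; field_simp
  have hT' : 32 * (g * (s ^ 2 + s * L + Real.posLog (r 0 / ε) + 1)) ≤ (T : ℝ) := by
    rw [hs2] at hT
    have : σ * L / Real.sqrt ε = s * L := by rw [hs]; ring
    rwa [this] at hT
  have stage1 : ∀ t ≤ N + 1, r t ≤ Real.exp (-(1 / (2 * g) * t)) * r 0 + σ ^ 2 := by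
    refine geometric_recursion_le ?_ (by positivity) ?_ hr
    · rw [div_le_one (by positivity)]; linarith
    · intro t ht
      have := h (μ / (2 * (μ ^ 2 * g))) t (by rw [stepSize, if_pos (by omega)]) le_rfl
      refine this.trans (le_of_eq ?_)
      field_simp
  have stage2 : ∀ t, N + 1 ≤ t →
      (t : ℝ) ^ 2 * r t ≤ ((N + 1 : ℕ) : ℝ) ^ 2 * r (N + 1) + 4 * (2 * g * σ ^ 2) * t := by
    refine harmonic_recursion_le (by positivity) ?_
    intro t ht
    have htR : (N : ℝ) + 1 ≤ t := by exact_mod_cast ht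
    have hge : 4 * g ≤ (t : ℝ) + 1 := by nlinarith [mul_nonneg hg0.le hL0]
    have hp : (0 : ℝ) < (t : ℝ) + 1 := by positivity
    have hle : 1 / μ * ((2 * t + 1) / ((t : ℝ) + 1) ^ 2) ≤ μ / (2 * (μ ^ 2 * g)) := by
      have h1 : (2 * t + 1) / ((t : ℝ) + 1) ^ 2 ≤ 1 / (2 * g) := by
        rw [div_le_div_iff₀ (by positivity) (by positivity)]
        nlinarith
      calc 1 / μ * ((2 * t + 1) / ((t : ℝ) + 1) ^ 2) ≤ 1 / μ * (1 / (2 * g)) := by gcongr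
        _ = μ / (2 * (μ ^ 2 * g)) := by field_simp
    have := h (1 / μ * ((2 * t + 1) / ((t : ℝ) + 1) ^ 2)) t
      (by rw [stepSize, if_neg (by omega)]) hle
    refine this.trans (le_of_eq ?_)
    field_simp
  rcases le_or_gt T (N + 1) with hTN | hTN
  · have hTR : (T : ℝ) ≤ N + 1 := by exact_mod_cast hTN
    -- If `T` falls in the first stage then the noise floor is already at most `ε/2`: otherwise `s >
    -- 1/2`, and the assumed size of `T` would exceed `5g + 2gL ≥ N + 1`.
    have hσε : s ^ 2 ≤ 1 / 2 := by
      by_contra hcon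
      push Not at hcon
      have hs3 : 1 / 2 < s := by nlinarith
      have h1 : 32 * (g * (1 / 2 + 1 / 2 * L + 0 + 1))
          ≤ 32 * (g * (s ^ 2 + s * L + Real.posLog (r 0 / ε) + 1)) := by gcongr
      nlinarith [mul_nonneg hg0.le hL0]
    have h2 := stage1 T hTN
    -- The `+ 1` in the bound on `T` supplies the factor `exp (-1) ≤ 1/2`, so the transient takes
    -- the other half of `ε`.
    have h3 : Real.exp (-(1 / (2 * g) * T)) * r 0 ≤ ε / 2 := by
      rcases hr.eq_or_lt with h0 | h0
      · rw [← h0, mul_zero]; positivity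
      have h4 : Real.posLog (r 0 / ε) + 1 ≤ 1 / (2 * g) * T := by
        rw [div_mul_eq_mul_div, one_mul, le_div_iff₀ (by positivity)]
        have h1 : 32 * (g * (0 + 0 + Real.posLog (r 0 / ε) + 1))
          ≤ 32 * (g * (s ^ 2 + s * L + Real.posLog (r 0 / ε) + 1)) := by gcongr <;> positivity
        nlinarith [mul_nonneg hg0.le hE0]
      have h5 : Real.log (r 0 / ε) ≤ Real.posLog (r 0 / ε) := le_max_right _ _
      have h6 : r 0 ≤ ε * Real.exp (Real.posLog (r 0 / ε)) := by
        have := Real.exp_le_exp.2 h5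
        rw [Real.exp_log (by positivity), div_le_iff₀ hε] at this
        linarith
      have h7 : Real.exp (-(1 / (2 * g) * T))
          ≤ Real.exp (-1) * Real.exp (-Real.posLog (r 0 / ε)) := by
        rw [← Real.exp_add]; exact Real.exp_le_exp.2 (by linarith)
      have h8 : Real.exp (-1) ≤ 1 / 2 := by
        rw [Real.exp_neg, one_div]
        exact inv_anti₀ (by norm_num) (by have := Real.add_one_le_exp 1; linarith)
      calc Real.exp (-(1 / (2 * g) * T)) * r 0
          ≤ (Real.exp (-1) * Real.exp (-Real.posLog (r 0 / ε)))
            * (ε * Real.exp (Real.posLog (r 0 / ε))) := by gcongr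
        _ = Real.exp (-1) * ε := by
            rw [Real.exp_neg (Real.posLog _)]; field_simp
        _ ≤ ε / 2 := by nlinarith
    nlinarith
  · have hTR : (N : ℝ) + 1 ≤ T := by exact_mod_cast hTN.le
    have hTpos : (0 : ℝ) < T := lt_of_lt_of_le (by positivity) hTR
    have h2 := stage2 T hTN.le
    have h3 : r (N + 1) ≤ 2 * σ ^ 2 := by
      have h4 := stage1 (N + 1) le_rfl
      have h5 : Real.exp (-(1 / (2 * g) * (N + 1 : ℕ))) * r 0 ≤ σ ^ 2 := by
        rcases hr.eq_or_lt with h0 | h0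
        · rw [← h0, mul_zero]; positivity
        have h6 : L ≤ 1 / (2 * g) * (N + 1 : ℕ) := by
          rw [div_mul_eq_mul_div, one_mul, le_div_iff₀ (by positivity)]
          push_cast
          nlinarith
        have h7 : Real.log (r 0 / σ ^ 2) ≤ L := le_max_right _ _
        have h8 : r 0 ≤ σ ^ 2 * Real.exp L := by
          have := Real.exp_le_exp.2 h7
          rw [Real.exp_log (by positivity), div_le_iff₀ (by positivity)] at this
          linarith
        calc Real.exp (-(1 / (2 * g) * (N + 1 : ℕ))) * r 0
            ≤ Real.exp (-L) * (σ ^ 2 * Real.exp L) := by gcongr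
          _ = σ ^ 2 := by rw [Real.exp_neg]; field_simp
      linarith
    have h9 : ((N + 1 : ℕ) : ℝ) ^ 2 * r (N + 1) ≤ (5 * g + 2 * g * L) ^ 2 * (2 * σ ^ 2) := by
      push_cast
      calc ((N : ℝ) + 1) ^ 2 * r (N + 1) ≤ ((N : ℝ) + 1) ^ 2 * (2 * σ ^ 2) := by gcongr
        _ ≤ _ := by gcongr
    -- The term linear in `s` is absorbed by `2s ≤ s² + 1`. Squared, this makes the initial error of
    -- the second stage at most `T² ε / 2`; `h11` bounds the accumulated noise by the same amount.
    have h10 : 2 * (5 * g + 2 * g * L) * s ≤ T := by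
      have : 32 * (g * (s ^ 2 + s * L + 0 + 1))
          ≤ 32 * (g * (s ^ 2 + s * L + Real.posLog (r 0 / ε) + 1)) := by gcongr
      have e1 : 0 ≤ g * (s * L) := by positivity
      have e2 : 0 ≤ g * (s - 1) ^ 2 := by positivity
      have e3 : 0 ≤ g * s ^ 2 := by positivity
      linarith
    have h11 : 16 * g * s ^ 2 ≤ T := by
      have : 32 * (g * (s ^ 2 + 0 + 0 + 0))
          ≤ 32 * (g * (s ^ 2 + s * L + Real.posLog (r 0 / ε) + 1)) := by gcongr <;> positivity
      have e3 : 0 ≤ g * s ^ 2 := by positivity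
      linarith
    have h12 : (2 * (5 * g + 2 * g * L) * s) ^ 2 ≤ (T : ℝ) ^ 2 :=
      pow_le_pow_left₀ (by positivity) h10 2
    have h13 : (T : ℝ) ^ 2 * r T ≤ (T : ℝ) ^ 2 * ε := by
      rw [hσs] at h2 h9
      have e1 := mul_le_mul_of_nonneg_right h12 hε.le
      have e2 := mul_le_mul_of_nonneg_right h11 (mul_nonneg hTpos.le hε.le)
      linarith
    exact le_of_mul_le_mul_left h13 (by positivity)

/-- The doubled right side has a spare `σ²/ε`, which outgrows everything of order `1/√ε`. The
logarithm in `ε` is of that order by `log x ≤ x - 1` at `x = √D/√ε`; replacing `log⁺(D/σ²)` by `2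
log D`, possibly negative, costs a fixed multiple of `1/√ε`. -/
lemma exists_small_accuracy {σ D : ℝ} (hσ : 0 < σ) (hD : 0 ≤ D) :
    ∃ ε₀ : ℝ, 0 < ε₀ ∧ ∀ ε, 0 < ε → ε ≤ ε₀ →
      σ ^ 2 / ε + σ * Real.posLog (D / σ ^ 2) / Real.sqrt ε + Real.posLog (D / ε) + 1
        ≤ 2 * (σ ^ 2 / ε + σ * Real.log D / Real.sqrt ε) := by
  set L := Real.posLog (D / σ ^ 2)
  -- `K` collects the coefficients of `1/√ε`; the threshold `s₀` is what `K/s + 1 ≤ σ²/s²` requires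
  -- for `s ≤ 1`.
  set K := σ * |L - 2 * Real.log D| + 2 * Real.sqrt D with hK
  have hK0 : 0 ≤ K := by positivity
  set s₀ := min 1 (σ ^ 2 / (K + 1)) with hs₀
  have hs₀p : 0 < s₀ := lt_min one_pos (by positivity)
  refine ⟨s₀ ^ 2, by positivity, fun ε hε hle => ?_⟩
  set s := Real.sqrt ε with hs
  have hsp : 0 < s := Real.sqrt_pos.2 hε
  have hεs : ε = s ^ 2 := (Real.sq_sqrt hε.le).symm
  have hss : s ≤ s₀ := Real.sqrt_le_iff.2 ⟨hs₀p.le, hle⟩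
  have h1 : s ≤ 1 := hss.trans (min_le_left _ _)
  have h2 : s * (K + 1) ≤ σ ^ 2 := by
    rw [← le_div_iff₀ (by positivity)]; exact hss.trans (min_le_right _ _)
  have h3 : Real.posLog (D / ε) ≤ 2 * (Real.sqrt D / s) := by
    refine max_le (by positivity) ?_
    rcases hD.eq_or_lt with h0 | h0
    · rw [← h0]; simp
    have h4 : D / ε = (Real.sqrt D / s) ^ 2 := by rw [div_pow, Real.sq_sqrt hD, ← hεs]
    rw [h4, Real.log_pow]
    have := Real.log_le_sub_one_of_pos (x := Real.sqrt D / s)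
      (div_pos (Real.sqrt_pos.2 h0) hsp)
    push_cast
    linarith
  have h5 : σ * L / s - 2 * (σ * Real.log D / s) ≤ σ * |L - 2 * Real.log D| / s := by
    have := mul_le_mul_of_nonneg_left (le_abs_self (L - 2 * Real.log D)) hσ.le
    rw [← mul_div_assoc, ← sub_div]
    gcongr
    linarith
  have h6 : K / s + 1 ≤ σ ^ 2 / ε := by
    rw [hεs, le_div_iff₀ (by positivity)]
    have : (K / s + 1) * s ^ 2 = s * (K + s) := by field_simp
    nlinarith
  have h7 : K / s = σ * |L - 2 * Real.log D| / s + 2 * (Real.sqrt D / s) := by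
    rw [hK]; ring
  linarith

/-! ### Stochastic proximal gradient descent -/

section SPGD

variable {d : ℕ} {φ : Measure ℝ} {ell : Vec d → ℝ} {μ δ : ℝ} {H : Matrix (Fin d) (Fin d) ℝ}
  {h : Param d → EReal} {Ω : Type*}
  {u : ℕ → Ω → (Fin d → ℝ)} {lam : ℕ → Ω → Param d} {γ : ℕ → ℝ} {lam₀ : Param d}

/-- The information generated by `u_0, …, u_{t-1}`. -/
@[reducible]
def past (u : ℕ → Ω → (Fin d → ℝ)) (t : ℕ) : MeasurableSpace Ω :=
  ⨆ i ∈ Set.Iio t, MeasurableSpace.comap (u i) inferInstance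

lemma past_mono (u : ℕ → Ω → (Fin d → ℝ)) (t : ℕ) : past u t ≤ past u (t + 1) :=
  biSup_mono fun _ hi => lt_trans hi (Nat.lt_succ_self t)

lemma comap_le_past (u : ℕ → Ω → (Fin d → ℝ)) (t : ℕ) :
    MeasurableSpace.comap (u t) inferInstance ≤ past u (t + 1) :=
  le_biSup (fun i => MeasurableSpace.comap (u i) inferInstance)
    (show t ∈ Set.Iio (t + 1) from Nat.lt_succ_self t)

/-- Measurability of the iterates is not assumed. It follows because each iterate is a continuous
function of the previous one and of the fresh noise, even where the proximal map is only partially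
defined. -/
lemma IsSPGD.measurable_past (hH : HasAlmostConstantHessian ell H δ) (hh : IsRegularizer h)
    (hγ : ∀ t, 0 < γ t) (hl : IsSPGD ell h γ lam₀ u lam) (t : ℕ) :
    Measurable[past u t] (lam t) := by
  induction t with
  | zero =>
    have : lam 0 = fun _ => lam₀ := funext hl.init
    rw [this]
    exact measurable_const
  | succ t ih =>
    obtain ⟨p, hp, hpe⟩ := exists_continuous_prox hh (hγ t)
    have h1 : Measurable[past u (t + 1)] (lam t) := ih.mono (past_mono u t) le_rfl
    have h2 : Measurable[past u (t + 1)] (u t) :=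
      (comap_measurable (u t)).mono (comap_le_past u t) le_rfl
    have h3 : Measurable[past u (t + 1)] fun ω => (lam t ω, u t ω) :=
      h1.prodMk h2
    have hcont : Continuous fun q : Param d × (Fin d → ℝ) =>
        p (q.1 - γ t • reparamGrad ell q.1 q.2) := by
      have hgrad := hH.continuous_reparamGrad
      fun_prop
    have h4 : lam (t + 1) = (fun q : Param d × (Fin d → ℝ) =>
        p (q.1 - γ t • reparamGrad ell q.1 q.2)) ∘ fun ω => (lam t ω, u t ω) :=
      funext fun ω => hpe _ _ (hl.step t ω)
    rw [h4]
    exact hcont.measurable.comp h3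

variable [MeasurableSpace Ω] {P : Measure Ω}

lemma IsNoise.past_le (hu : IsNoise P φ u) (t : ℕ) : past u t ≤ ‹MeasurableSpace Ω› :=
  iSup₂_le fun i _ => (hu.measurable i).comap_le

lemma IsSPGD.measurable (hH : HasAlmostConstantHessian ell H δ) (hh : IsRegularizer h)
    (hγ : ∀ t, 0 < γ t) (hu : IsNoise P φ u) (hl : IsSPGD ell h γ lam₀ u lam) (t : ℕ) :
    Measurable (lam t) :=
  (hl.measurable_past hH hh hγ t).mono (hu.past_le t) le_rfl

lemma IsSPGD.indepFun (hH : HasAlmostConstantHessian ell H δ) (hh : IsRegularizer h)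
    (hγ : ∀ t, 0 < γ t) (hu : IsNoise P φ u) (hl : IsSPGD ell h γ lam₀ u lam) (t : ℕ) :
    IndepFun (lam t) (u t) P := by
  rw [IndepFun_iff_Indep]
  have h1 : Indep (past u t) (⨆ i ∈ ({t} : Set ℕ), MeasurableSpace.comap (u i) inferInstance) P :=
    indep_iSup_of_disjoint (fun i => (hu.measurable i).comap_le)
      ((iIndepFun_iff_iIndep _ _ _).1 hu.indep) (by simp)
  rw [iSup_singleton] at h1
  exact indep_of_indep_of_le_left h1 (hl.measurable_past hH hh hγ t).comap_le

/-- Independence turns the joint law of `(λ_t, u_t)` into a product, so the one-step bound applies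
with `λ_t` frozen. Working with `∫⁻` requires no prior integrability of the next iterate. -/
lemma IsSPGD.lintegral_step_le [IsProbabilityMeasure P] (hφ : IsBase φ)
    (hc : IsStronglyConvex ell μ) (hH : HasAlmostConstantHessian ell H δ) (hh : IsRegularizer h)
    {z : Vec d} (hz : IsMinOn ell Set.univ z) {lamStar : Param d}
    (ho : IsOptimum ell φ h lamStar) (hγ : ∀ t, 0 < γ t) (hu : IsNoise P φ u)
    (hl : IsSPGD ell h γ lam₀ u lam) (t : ℕ) :
    ∫⁻ ω, ENNReal.ofReal (‖lam (t + 1) ω - lamStar‖ ^ 2) ∂P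
      ≤ ∫⁻ ω, ENNReal.ofReal
        ((1 - 2 * γ t * μ + 2 * γ t ^ 2 * (μ ^ 2 * gConst H δ μ φ)) * ‖lam t ω - lamStar‖ ^ 2
          + 2 * γ t ^ 2 * (μ ^ 2 * gConst H δ μ φ) * sigmaStar lamStar z ^ 2) ∂P := by
  have hb := hφ.isProbabilityMeasure_baseLaw (d := d)
  set G := meanGrad ell φ lamStar with hG
  let Ψ : Param d × (Fin d → ℝ) → ENNReal := fun q =>
    ENNReal.ofReal (‖q.1 - lamStar - γ t • (reparamGrad ell q.1 q.2 - G)‖ ^ 2)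
  have hΨ : Measurable Ψ := by
    have hgrad := hH.continuous_reparamGrad
    have hcont : Continuous fun q : Param d × (Fin d → ℝ) =>
        ‖q.1 - lamStar - γ t • (reparamGrad ell q.1 q.2 - G)‖ ^ 2 := by fun_prop
    exact hcont.measurable.ennreal_ofReal
  have hml := hl.measurable hH hh hγ hu t
  have hmu := hu.measurable t
  have hmap : P.map (fun ω => (lam t ω, u t ω)) = (P.map (lam t)).prod (baseLaw d φ) := by
    rw [← hu.law t]
    exact (indepFun_iff_map_prod_eq_prod_map_map hml.aemeasurable hmu.aemeasurable).1
      (hl.indepFun hH hh hγ hu t)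
  have hbound : Measurable fun x : Param d => ENNReal.ofReal
      ((1 - 2 * γ t * μ + 2 * γ t ^ 2 * (μ ^ 2 * gConst H δ μ φ)) * ‖x - lamStar‖ ^ 2
        + 2 * γ t ^ 2 * (μ ^ 2 * gConst H δ μ φ) * sigmaStar lamStar z ^ 2) := by
    have hcont : Continuous fun x : Param d =>
      ((1 - 2 * γ t * μ + 2 * γ t ^ 2 * (μ ^ 2 * gConst H δ μ φ)) * ‖x - lamStar‖ ^ 2
        + 2 * γ t ^ 2 * (μ ^ 2 * gConst H δ μ φ) * sigmaStar lamStar z ^ 2) := by fun_prop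
    exact hcont.measurable.ennreal_ofReal
  calc ∫⁻ ω, ENNReal.ofReal (‖lam (t + 1) ω - lamStar‖ ^ 2) ∂P
      ≤ ∫⁻ ω, Ψ (lam t ω, u t ω) ∂P := by
        refine lintegral_mono fun ω => ENNReal.ofReal_le_ofReal ?_
        refine pow_le_pow_left₀ (norm_nonneg _) ?_ 2
        refine ((hl.step t ω).norm_sub_optimum_le hφ hc hH hh (hγ t) ho).trans (le_of_eq ?_)
        congr 1
        rw [smul_sub]
        abel
    _ = ∫⁻ q, Ψ q ∂(P.map fun ω => (lam t ω, u t ω)) :=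
        (lintegral_map hΨ (hml.prodMk hmu)).symm
    _ = ∫⁻ x, ∫⁻ w, Ψ (x, w) ∂(baseLaw d φ) ∂(P.map (lam t)) := by
        rw [hmap, lintegral_prod _ hΨ.aemeasurable]
    _ ≤ ∫⁻ x, ENNReal.ofReal
        ((1 - 2 * γ t * μ + 2 * γ t ^ 2 * (μ ^ 2 * gConst H δ μ φ)) * ‖x - lamStar‖ ^ 2
          + 2 * γ t ^ 2 * (μ ^ 2 * gConst H δ μ φ) * sigmaStar lamStar z ^ 2)
          ∂(P.map (lam t)) :=
        lintegral_mono fun x => lintegral_gradient_step_le hφ hc hH hz x lamStar (hγ t).le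
    _ = _ := lintegral_map hbound hml

/-- With `a = ‖H‖/μ` and `b = δ/μ`, the bounds `r₄ ≥ 1` and `E max u_j² ≥ 1` give `g ≥ 4a² + 10b² ≥
2(a + b)²`, and `a + b ≥ 1` because the Lipschitz constant of `∇ℓ` is at least `μ`. -/
lemma two_le_gConst (hd : 0 < d) (hφ : IsBase φ) (hc : IsStronglyConvex ell μ)
    (hH : HasAlmostConstantHessian ell H δ) : 2 ≤ gConst H δ μ φ := by
  have hμ := hc.1
  have h1 := hφ.one_le_kurt
  have h2 := hφ.one_le_expMaxSq hd
  have h3 := le_smoothness hd hc hH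
  have h4 : 1 ≤ ‖op H‖ / μ + δ / μ := by
    rw [← add_div, le_div_iff₀ hμ, one_mul]
    exact h3
  unfold gConst
  rw [← div_pow, ← div_pow]
  set a := ‖op H‖ / μ
  set b := δ / μ
  nlinarith [mul_le_mul_of_nonneg_right h1 (sq_nonneg a),
    mul_le_mul_of_nonneg_right h1 (sq_nonneg b), mul_le_mul_of_nonneg_right h2 (sq_nonneg b),
    sq_nonneg (a - b), sq_nonneg (a + b - 1)]

lemma sigmaStar_pos (hd : 0 < d) {lamStar : Param d} (hl : lamStar ∈ paramSet d) (z : Vec d) :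
    0 < sigmaStar lamStar z := by
  refine Real.sqrt_pos.2 (add_pos_of_nonneg_of_pos (sq_nonneg _) ?_)
  rw [norm_sq_eq_sum]
  have : Nonempty (Fin d) := ⟨⟨0, hd⟩⟩
  exact Finset.sum_pos (fun i _ => pow_pos (hl i) 2) Finset.univ_nonempty

/-- With `g ≥ 2` the expression is at least `(1 - γμ)² + 3(γμ)²`. Nonnegativity keeps
`ENNReal.ofReal` from truncating in the passage back to real integrals. -/
lemma contraction_factor_nonneg {g : ℝ} (hg : 2 ≤ g) (μ γ : ℝ) :
    0 ≤ 1 - 2 * γ * μ + 2 * γ ^ 2 * (μ ^ 2 * g) := by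
  nlinarith [sq_nonneg (1 - γ * μ), mul_le_mul_of_nonneg_left hg (sq_nonneg (γ * μ)),
    sq_nonneg (γ * μ)]

lemma IsSPGD.integrable_and_integral_step_le [IsProbabilityMeasure P] (hd : 0 < d)
    (hφ : IsBase φ) (hc : IsStronglyConvex ell μ) (hH : HasAlmostConstantHessian ell H δ)
    (hh : IsRegularizer h) {z : Vec d} (hz : IsMinOn ell Set.univ z) {lamStar : Param d}
    (ho : IsOptimum ell φ h lamStar) (hγ : ∀ t, 0 < γ t) (hu : IsNoise P φ u)
    (hl : IsSPGD ell h γ lam₀ u lam) (t : ℕ)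
    (hI : Integrable (fun ω => ‖lam t ω - lamStar‖ ^ 2) P) :
    Integrable (fun ω => ‖lam (t + 1) ω - lamStar‖ ^ 2) P ∧
    ∫ ω, ‖lam (t + 1) ω - lamStar‖ ^ 2 ∂P
      ≤ (1 - 2 * γ t * μ + 2 * γ t ^ 2 * (μ ^ 2 * gConst H δ μ φ))
          * ∫ ω, ‖lam t ω - lamStar‖ ^ 2 ∂P
        + 2 * γ t ^ 2 * (μ ^ 2 * gConst H δ μ φ) * sigmaStar lamStar z ^ 2 := by
  have hg := two_le_gConst hd hφ hc hH
  have hstep := hl.lintegral_step_le hφ hc hH hh hz ho hγ hu t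
  have ha := contraction_factor_nonneg hg μ (γ t)
  set a := 1 - 2 * γ t * μ + 2 * γ t ^ 2 * (μ ^ 2 * gConst H δ μ φ)
  set b := 2 * γ t ^ 2 * (μ ^ 2 * gConst H δ μ φ) * sigmaStar lamStar z ^ 2 with hbdef
  have hb : 0 ≤ b := by
    have : 0 ≤ gConst H δ μ φ := by linarith
    positivity
  have hIb : Integrable (fun ω => a * ‖lam t ω - lamStar‖ ^ 2 + b) P :=
    (hI.const_mul a).add (integrable_const b)
  have hmeas := hl.measurable hH hh hγ hu (t + 1)
  have hm : AEStronglyMeasurable (fun ω => ‖lam (t + 1) ω - lamStar‖ ^ 2) P :=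
    (((hmeas.sub_const lamStar).norm).pow_const 2).aestronglyMeasurable
  rw [← ofReal_integral_eq_lintegral_ofReal hIb (ae_of_all _ fun ω => by
    simp only [Pi.zero_apply]; positivity)] at hstep
  have hI' : Integrable (fun ω => ‖lam (t + 1) ω - lamStar‖ ^ 2) P :=
    ⟨hm, (hasFiniteIntegral_iff_ofReal (ae_of_all _ fun ω => sq_nonneg _)).2
      (hstep.trans_lt ENNReal.ofReal_lt_top)⟩
  refine ⟨hI', ?_⟩
  rw [← ofReal_integral_eq_lintegral_ofReal hI' (ae_of_all _ fun ω => sq_nonneg _),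
    integral_add (hI.const_mul a) (integrable_const b), integral_const_mul] at hstep
  simp only [integral_const, probReal_univ, smul_eq_mul, one_mul] at hstep
  refine (ENNReal.ofReal_le_ofReal_iff ?_).1 hstep
  have : 0 ≤ ∫ ω, ‖lam t ω - lamStar‖ ^ 2 ∂P := integral_nonneg fun ω => sq_nonneg _
  positivity

lemma stepSize_pos (hμ : 0 < μ) {γ₀ : ℝ} (hγ₀ : 0 < γ₀) (tstar t : ℕ) :
    0 < stepSize μ γ₀ tstar t := by
  unfold stepSize
  split_ifs
  · exact hγ₀
  · positivity

/-- The mean square error of the two-stage schedule. -/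
theorem IsSPGD.meanSqErrorLE [IsProbabilityMeasure P] (hd : 0 < d)
    (hφ : IsBase φ) (hc : IsStronglyConvex ell μ) (hH : HasAlmostConstantHessian ell H δ)
    (hh : IsRegularizer h) {z : Vec d} (hz : IsMinOn ell Set.univ z) {lamStar : Param d}
    (ho : IsOptimum ell φ h lamStar) (hu : IsNoise P φ u)
    (hl : IsSPGD ell h (stepSize μ (μ / (2 * (μ ^ 2 * gConst H δ μ φ)))
      (switchTime (gConst H δ μ φ)
        (Real.posLog (‖lam₀ - lamStar‖ ^ 2 / sigmaStar lamStar z ^ 2)))) lam₀ u lam)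
    {ε : ℝ} (hε : 0 < ε) {T : ℕ}
    (hT : 32 * (gConst H δ μ φ * (sigmaStar lamStar z ^ 2 / ε + sigmaStar lamStar z
        * Real.posLog (‖lam₀ - lamStar‖ ^ 2 / sigmaStar lamStar z ^ 2) / Real.sqrt ε
      + Real.posLog (‖lam₀ - lamStar‖ ^ 2 / ε) + 1)) ≤ (T : ℝ)) :
    MeanSqErrorLE P (lam T) lamStar ε := by
  have hμ := hc.1
  have hg := two_le_gConst hd hφ hc hH
  have hg0 : 0 < gConst H δ μ φ := by linarith
  have hγ := stepSize_pos hμ (γ₀ := μ / (2 * (μ ^ 2 * gConst H δ μ φ))) (by positivity)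
    (switchTime (gConst H δ μ φ)
        (Real.posLog (‖lam₀ - lamStar‖ ^ 2 / sigmaStar lamStar z ^ 2)))
  have hI : ∀ t, Integrable (fun ω => ‖lam t ω - lamStar‖ ^ 2) P := by
    intro t
    induction t with
    | zero => simp_rw [hl.init]; exact integrable_const _
    | succ t ih =>
      exact (hl.integrable_and_integral_step_le hd hφ hc hH hh hz ho hγ hu t ih).1
  refine ⟨hI T, ?_⟩
  let r : ℕ → ℝ := fun t => ∫ ω, ‖lam t ω - lamStar‖ ^ 2 ∂P
  have hr0 : r 0 = ‖lam₀ - lamStar‖ ^ 2 := by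
    simp only [r, hl.init, integral_const, probReal_univ, smul_eq_mul, one_mul]
  rw [← hr0] at hl hT
  refine two_stage_recursion (r := r) hμ hg (sigmaStar_pos hd ho.1 z)
    (integral_nonneg fun ω => sq_nonneg _) ?_ hε hT
  intro γ t hγt hγle
  have hγ' := stepSize_pos hμ (γ₀ := μ / (2 * (μ ^ 2 * gConst H δ μ φ))) (by positivity)
    (switchTime (gConst H δ μ φ) (Real.posLog (r 0 / sigmaStar lamStar z ^ 2)))
  have h1 := (hl.integrable_and_integral_step_le hd hφ hc hH hh hz ho hγ' hu t (hI t)).2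
  have hγ0 : 0 < γ := hγt ▸ hγ' t
  rw [← hγt] at h1
  -- The step size restriction: the multiplicative noise consumes at most half of the contraction
  -- `2γμ`.
  have h2 : 2 * γ ^ 2 * (μ ^ 2 * gConst H δ μ φ) ≤ γ * μ := by
    rw [le_div_iff₀ (by positivity)] at hγle
    nlinarith
  have h3 : 0 ≤ r t := integral_nonneg fun ω => sq_nonneg _
  have h4 := mul_le_mul_of_nonneg_right h2 h3
  change r (t + 1) ≤ (1 - 2 * γ * μ + 2 * γ ^ 2 * (μ ^ 2 * gConst H δ μ φ)) * r t + _ at h1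
  linarith

end SPGD

end BBVI

end

/-! ### The complexity theorem -/

theorem mainTheorem1 :
    ∃ c : ℝ, 0 < c ∧
      ∀ (d : ℕ) (_ : 0 < d) (φ : Measure ℝ) (_ : BBVI.IsBase φ)
        (ell : BBVI.Vec d → ℝ) (μ δ L : ℝ) (H : Matrix (Fin d) (Fin d) ℝ)
        (_ : BBVI.IsStronglyConvex ell μ)
        (_ : BBVI.HasAlmostConstantHessian ell H δ)
        (_ : μ ≤ BBVI.sigmaMin H) (_ : BBVI.sigmaMin H ≤ BBVI.sigmaMax H)
        (_ : BBVI.sigmaMax H ≤ L)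
        (h : BBVI.Param d → EReal) (_ : BBVI.IsRegularizer h),
        -- the stationary point of `ell` exists and is unique
        (∃! zbar : BBVI.Vec d, IsMinOn ell Set.univ zbar) ∧
        -- the optimum and the proximal operator are well defined
        (BBVI.IsClosedRegularizer h →
          (∃! lamStar : BBVI.Param d, BBVI.IsOptimum ell φ h lamStar) ∧
          ∀ γ : ℝ, 0 < γ → ∀ x : BBVI.Param d, ∃! y : BBVI.Param d, BBVI.IsProx h γ x y) ∧
        -- the complexity guarantee
        ∀ (zbar : BBVI.Vec d) (_ : IsMinOn ell Set.univ zbar)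
          (lamStar : BBVI.Param d) (_ : BBVI.IsOptimum ell φ h lamStar)
          (lam₀ : BBVI.Param d) (_ : lam₀ ∈ BBVI.paramSet d),
          ∃ (tstar : ℕ) (γ₀ ε₀ : ℝ),
            0 < ε₀ ∧ 0 < γ₀ ∧ γ₀ ≤ μ / (2 * (μ ^ 2 * BBVI.gConst H δ μ φ)) ∧
            ∀ (Ω : Type*) (_ : MeasurableSpace Ω) (P : Measure Ω) (_ : IsProbabilityMeasure P)
              (u : ℕ → Ω → (Fin d → ℝ)) (_ : BBVI.IsNoise P φ u)
              (lam : ℕ → Ω → BBVI.Param d)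
              (_ : BBVI.IsSPGD ell h (BBVI.stepSize μ γ₀ tstar) lam₀ u lam),
              -- for every accuracy, with all lower-order terms
              (∀ (ε : ℝ) (_ : 0 < ε) (T : ℕ),
                c * (BBVI.gConst H δ μ φ *
                  (BBVI.sigmaStar lamStar zbar ^ 2 / ε
                    + BBVI.sigmaStar lamStar zbar
                        * Real.posLog (‖lam₀ - lamStar‖ ^ 2 / BBVI.sigmaStar lamStar zbar ^ 2)
                        / Real.sqrt ε
                    + Real.posLog (‖lam₀ - lamStar‖ ^ 2 / ε) + 1)) ≤ (T : ℝ) →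
                BBVI.MeanSqErrorLE P (lam T) lamStar ε) ∧
              -- for all sufficiently small accuracies, with the leading terms only
              (∀ (ε : ℝ) (_ : 0 < ε) (_ : ε ≤ ε₀) (T : ℕ),
                c * (BBVI.gConst H δ μ φ *
                  (BBVI.sigmaStar lamStar zbar ^ 2 / ε
                    + BBVI.sigmaStar lamStar zbar * Real.log (‖lam₀ - lamStar‖ ^ 2)
                        / Real.sqrt ε)) ≤ (T : ℝ) →
                BBVI.MeanSqErrorLE P (lam T) lamStar ε) := by
  -- `64 = 2 * 32`: the recursion needs `32`, and dropping the lower-order terms for small `ε` costs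
  -- the factor `2` of `exists_small_accuracy`.
  refine ⟨64, by norm_num, ?_⟩
  intro d hd φ hφ ell μ δ L H hc hH _ _ _ h hh
  refine ⟨BBVI.existsUnique_minimizer hc, fun hcl =>
    ⟨BBVI.existsUnique_isOptimum hφ hc hH hh hcl,
      fun γ hγ x => BBVI.existsUnique_isProx hh hcl hγ x⟩, ?_⟩
  intro zbar hz lamStar ho lam₀ _
  have hg : 2 ≤ BBVI.gConst H δ μ φ := BBVI.two_le_gConst hd hφ hc hH
  have hg0 : 0 < BBVI.gConst H δ μ φ := by linarith
  have hσ := BBVI.sigmaStar_pos hd ho.1 zbar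
  have hμ := hc.1
  obtain ⟨ε₀, hε₀, hsmall⟩ :=
    BBVI.exists_small_accuracy hσ (sq_nonneg ‖lam₀ - lamStar‖)
  refine ⟨BBVI.switchTime (BBVI.gConst H δ μ φ)
      (Real.posLog (‖lam₀ - lamStar‖ ^ 2 / BBVI.sigmaStar lamStar zbar ^ 2)),
    μ / (2 * (μ ^ 2 * BBVI.gConst H δ μ φ)), ε₀, hε₀, by positivity, le_rfl, ?_⟩
  intro Ω _ P _ u hu lam hl
  refine ⟨fun ε hε T hT => ?_, fun ε hε hεle T hT => ?_⟩
  · refine hl.meanSqErrorLE hd hφ hc hH hh hz ho hu hε (le_trans ?_ hT)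
    have h1 : 0 ≤ Real.posLog (‖lam₀ - lamStar‖ ^ 2 / BBVI.sigmaStar lamStar zbar ^ 2) :=
      Real.posLog_nonneg
    have h2 : 0 ≤ Real.posLog (‖lam₀ - lamStar‖ ^ 2 / ε) := Real.posLog_nonneg
    exact mul_le_mul_of_nonneg_right (by norm_num) (by positivity)
  · refine hl.meanSqErrorLE hd hφ hc hH hh hz ho hu hε (le_trans ?_ hT)
    have h1 := mul_le_mul_of_nonneg_left (hsmall ε hε hεle) hg0.le
    linarith
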